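/- Let $\Omega=(0,1)^2$ and $1<\alpha,\beta<2$. For $0<\mu<1$ let ${}_0D_x^{\mu}$, ${}_xD_1^{\mu}$, ${}_0D_y^{\mu}$, ${}_yD_1^{\mu}$ be the left- and right-sided Riemann–Liouville derivatives in $x$ and in $y$ on $\Omega$, i.e. ${}_0D_x^\mu v(x,y)=\frac1{\Gamma(1-\mu)}\frac{\partial}{\partial x}\int_0^x (x-\xi)^{-\mu}v(\xi,y)\,d\xi$, ${}_xD_1^\mu v(x,y)=\frac{-1}{\Gamma(1-\mu)}\frac{\partial}{\partial x}\int_x^1 (\xi-x)^{-\mu}v(\xi,y)\,d\xi$, and likewise in $y$. Let $(\cdot,\cdot)$ and $\|\cdot\|$ be the inner product and norm of $L^2(\Omega)$, $C_\gamma=\frac{1}{2\cos(\gamma\pi/2)}$, and $$a(u,v)=C_\alpha\big({}_0D_x^{\alpha/2}u,{}_xD_1^{\alpha/2}v\big)+C_\alpha\big({}_xD_1^{\alpha/2}u,{}_0D_x^{\alpha/2}v\big)+C_\beta\big({}_0D_y^{\beta/2}u,{}_yD_1^{\beta/2}v\big)+C_\beta\big({}_yD_1^{\beta/2}u,{}_0D_y^{\beta/2}v\big).$$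 Let $H_0^\mu(\Omega)$ be the closure of $C_c^\infty(\Omega)$ in $H^\mu(\Omega)=\{w|_\Omega: w\in H^\mu(\mathbb R^2)\}$ with the quotient norm. Let $\mathfrak T_h$ be a triangulation of $\Omega$ into closed triangles, let $m\ge1$, and let $X_h$ be the space of all $v\in H_0^{\alpha/2}(\Omega)\cap H_0^{\beta/2}(\Omega)\cap C^0(\Omega)$, extended by zero outside $\Omega$, that are polynomials of degree at most $m$ on each $K\in\mathfrak T_h$. Let $T>0$, $N\ge1$, $\tau=T/N$, $t_n=n\tau$, $f^n=f(t_n)\in L^2(\Omega)$ for $1\le n\le N$, and let $u_h^0,\dots,u_h^N\in X_h$ solve $$(u_h^n,v)+\tau\,a(u_h^n,v)=\tau(f^n,v)+(u_h^{n-1},v)\qquad\forall v\in X_h,\ 1\le n\le N .$$ Let $1\le n_1\le\dots\le n_L\le N$, let $U_i=u_h^{n_i}$ $(1\le i\le L)$ be the snapshots, and let $l=\dim\operatorname{span}\{U_1,\dots,U_L\}$. Let $\lambda_1\ge\dots\ge\lambda_l>0$ be eigenvalues, with orthonormal eigenvectors $\mathbf v^1,\dots,\mathbf v^l$, $\mathbf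 v^k=(a^k_1,\dots,a^k_L)$, of the correlation matrix $G=\big(\tfrac1L a(U_i,U_j)\big)_{i,j=1}^L$, let $\psi_k=\frac1{\sqrt{L\lambda_k}}\sum_{i=1}^L a_i^kU_i$ be the corresponding POD basis, and $W^d=\operatorname{span}\{\psi_1,\dots,\psi_d\}$ for $1\le d\le l$. Then there is a constant $C>0$ depending only on $\alpha$ and $\beta$ such that for every $d$ with $1\le d\le l$: for every $U\in X_h$ there is exactly one $P^dU\in W^d$ with $$a(P^dU,V)=a(U,V)\qquad\forall V\in W^d$$ (the Ritz projection $P^d:X_h\to W^d$ is well defined), the functions ${}_0D_x^{\alpha/2}(U_i-P^dU_i)$ and ${}_0D_y^{\beta/2}(U_i-P^dU_i)$ belong to $L^2(\Omega)$ for all $i$, and $$\frac1L\sum_{i=1}^L\big\|{}_0D_x^{\alpha/2}(U_i-P^dU_i)\big\|^2+\frac1L\sum_{i=1}^L\big\|{}_0D_y^{\beta/2}(U_i-P^dU_i)\big\|^2\le C\sum_{j=d+1}^l\lambda_j .$$ -/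

import Mathlib

namespace FracPOD

noncomputable section

open MeasureTheory

/-- The spatial domain `Ω = (0,1) × (0,1)`. -/
def Omega : Set (ℝ × ℝ) := Set.Ioo 0 1 ×ˢ Set.Ioo 0 1

/-! ### Riemann-Liouville derivatives on the unit interval -/

/-- The left-sided Riemann-Liouville derivative `₀D_x^μ g (x)` of order `0 < μ < 1`. -/
def rlLeft (μ : ℝ) (g : ℝ → ℝ) (x : ℝ) : ℝ :=
  1 / Real.Gamma (1 - μ) * deriv (fun s => ∫ ξ in (0 : ℝ)..s, (s - ξ) ^ (-μ) * g ξ) x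

/-- The right-sided Riemann-Liouville derivative `_xD₁^μ g (x)` of order `0 < μ < 1`. -/
def rlRight (μ : ℝ) (g : ℝ → ℝ) (x : ℝ) : ℝ :=
  -1 / Real.Gamma (1 - μ) * deriv (fun s => ∫ ξ in s..(1 : ℝ), (ξ - s) ^ (-μ) * g ξ) x

/-- `₀D_x^μ v`. -/
def leftX (μ : ℝ) (v : ℝ × ℝ → ℝ) (p : ℝ × ℝ) : ℝ := rlLeft μ (fun x => v (x, p.2)) p.1

/-- `_xD₁^μ v`. -/
def rightX (μ : ℝ) (v : ℝ × ℝ → ℝ) (p : ℝ × ℝ) : ℝ := rlRight μ (fun x => v (x, p.2)) p.1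

/-- `₀D_y^μ v`. -/
def leftY (μ : ℝ) (v : ℝ × ℝ → ℝ) (p : ℝ × ℝ) : ℝ := rlLeft μ (fun y => v (p.1, y)) p.2

/-- `_yD₁^μ v`. -/
def rightY (μ : ℝ) (v : ℝ × ℝ → ℝ) (p : ℝ × ℝ) : ℝ := rlRight μ (fun y => v (p.1, y)) p.2

/-- The `L²(Ω)` inner product. -/
def ip (f g : ℝ × ℝ → ℝ) : ℝ := ∫ p in Omega, f p * g p

/-- The square of the `L²(Ω)` norm. -/
def normSq (f : ℝ × ℝ → ℝ) : ℝ := ∫ p in Omega, f p ^ 2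

/-- The constant `C_γ = 1 / (2 cos (γ π / 2))`. -/
def rieszConst (γ : ℝ) : ℝ := 1 / (2 * Real.cos (γ * Real.pi / 2))

/-- The fractional bilinear form `a(u,v) = (u,v)_w`. -/
def form (α β : ℝ) (u v : ℝ × ℝ → ℝ) : ℝ :=
  rieszConst α * ip (leftX (α / 2) u) (rightX (α / 2) v)
    + rieszConst α * ip (rightX (α / 2) u) (leftX (α / 2) v)
    + rieszConst β * ip (leftY (β / 2) u) (rightY (β / 2) v)
    + rieszConst β * ip (rightY (β / 2) u) (leftY (β / 2) v)

/-! ### Fractional Sobolev spaces -/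

section Sobolev

open FourierTransform

/-- `‖w‖² + ‖|ω|^μ ŵ‖²`, the square of the norm of `H^μ(ℝ²)`, for `w ∈ L²(ℝ²)`. Mathlib's Fourier
variable `ξ` is the angular frequency `ω` divided by `2π`. The value is `∞` exactly when
`w ∉ H^μ(ℝ²)`. -/
def sobolevNormSq (μ : ℝ) (w : Lp ℂ 2 (volume : Measure (EuclideanSpace ℝ (Fin 2)))) : ENNReal :=
  (∫⁻ z, ‖w z‖ₑ ^ 2) + ∫⁻ ξ, ENNReal.ofReal ((2 * Real.pi * ‖ξ‖) ^ (2 * μ)) * ‖(𝓕 w) ξ‖ₑ ^ 2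

/-- Membership of (the restriction to `Ω` of) `v` in `H₀^μ(Ω)`, the closure of `C_c^∞(Ω)` in
`H^μ(Ω)`, the latter normed by the infimum of the `H^μ(ℝ²)` norms of the extensions: for every
`ε > 0` there is a test function `φ` such that `v - φ` has an extension `w` to `ℝ²` with
`‖w‖²_{H^μ(ℝ²)} < ε`. -/
def MemHZero (μ : ℝ) (v : ℝ × ℝ → ℝ) : Prop :=
  ∀ ε : ENNReal, 0 < ε →
    ∃ φ : ℝ × ℝ → ℝ, ContDiff ℝ (⊤ : ℕ∞) φ ∧ HasCompactSupport φ ∧ tsupport φ ⊆ Omega ∧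
      ∃ w : Lp ℂ 2 (volume : Measure (EuclideanSpace ℝ (Fin 2))),
        (∀ᵐ z : EuclideanSpace ℝ (Fin 2), (z 0, z 1) ∈ Omega →
          w z = ((v (z 0, z 1) - φ (z 0, z 1) : ℝ) : ℂ)) ∧
        sobolevNormSq μ w < ε

end Sobolev

/-! ### The finite element scheme -/

/-- A (conforming) triangulation of `Ω`. Each element is given by the set `s` of its three
vertices and is the closed triangle `convexHull ℝ s`; two elements meet in a common face. -/
structure IsTriangulation (Th : Finset (Finset (ℝ × ℝ))) : Prop where
  card_eq : ∀ s ∈ Th, s.card = 3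
  affineIndependent : ∀ s ∈ Th, AffineIndependent ℝ (fun p : s => (p : ℝ × ℝ))
  cover : (⋃ s ∈ Th, convexHull ℝ (s : Set (ℝ × ℝ))) = closure Omega
  conforming : ∀ s ∈ Th, ∀ t ∈ Th,
    convexHull ℝ (s : Set (ℝ × ℝ)) ∩ convexHull ℝ (t : Set (ℝ × ℝ)) =
      convexHull ℝ ((s : Set (ℝ × ℝ)) ∩ (t : Set (ℝ × ℝ)))

/-- The finite element space `X_h`: continuous functions in `H₀^{α/2}(Ω) ∩ H₀^{β/2}(Ω)`, extended
by zero to `ℝ²`, that are polynomials of degree at most `m` on every closed element. -/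
structure IsFEFunction (α β : ℝ) (m : ℕ) (Th : Finset (Finset (ℝ × ℝ))) (v : ℝ × ℝ → ℝ) :
    Prop where
  zero_off : ∀ p, p ∉ Omega → v p = 0
  continuousOn : ContinuousOn v Omega
  mem_x : MemHZero (α / 2) v
  mem_y : MemHZero (β / 2) v
  poly : ∀ s ∈ Th, ∃ q : MvPolynomial (Fin 2) ℝ, q.totalDegree ≤ m ∧
    ∀ p ∈ convexHull ℝ (s : Set (ℝ × ℝ)), v p = MvPolynomial.eval ![p.1, p.2] q

/-- `X_h`. -/
def feSpace (α β : ℝ) (m : ℕ) (Th : Finset (Finset (ℝ × ℝ))) : Set (ℝ × ℝ → ℝ) :=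
  {v | IsFEFunction α β m Th v}

/-- `u 0, …, u N ∈ X_h` solve the fully discrete (backward Euler) finite element scheme with
source `f`, final time `T`, step `τ = T / N` and some initial datum `u 0` in `X_h`. -/
structure IsFESolution (α β : ℝ) (X : Set (ℝ × ℝ → ℝ)) (T : ℝ) (N : ℕ)
    (f : ℝ → ℝ × ℝ → ℝ) (u : ℕ → ℝ × ℝ → ℝ) : Prop where
  mem : ∀ n ≤ N, u n ∈ X
  step : ∀ n, 1 ≤ n → n ≤ N → ∀ v ∈ X,
    ip (u n) v + T / N * form α β (u n) v = T / N * ip (f (n * (T / N))) v + ip (u (n - 1)) v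

/-! ### Proper orthogonal decomposition -/

/-- The correlation matrix `G_{ij} = (U_i, U_j)_w / L` of the snapshots. -/
def corrMatrix (α β : ℝ) {L : ℕ} (U : Fin L → ℝ × ℝ → ℝ) : Matrix (Fin L) (Fin L) ℝ :=
  Matrix.of fun i j => form α β (U i) (U j) / L

/-- `ψ_1, …, ψ_l` is a POD basis of the snapshots `U`: `l` is the dimension of their span,
`λ_1 ≥ … ≥ λ_l > 0` are eigenvalues of the correlation matrix with orthonormal eigenvectors
`a^1, …, a^l`, and `ψ_k = (L λ_k)^{-1/2} ∑ i, a^k_i U_i`. -/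
structure IsPOD (α β : ℝ) {L l : ℕ} (U : Fin L → ℝ × ℝ → ℝ) (lam : Fin l → ℝ)
    (a : Fin l → Fin L → ℝ) (ψ : Fin l → ℝ × ℝ → ℝ) : Prop where
  dim : Module.finrank ℝ (Submodule.span ℝ (Set.range U)) = l
  antitone : Antitone lam
  pos : ∀ k, 0 < lam k
  orthonormal : ∀ j k, a j ⬝ᵥ a k = if j = k then 1 else 0
  eigen : ∀ k, (corrMatrix α β U).mulVec (a k) = lam k • a k
  basis : ∀ k, ψ k = (1 / Real.sqrt (L * lam k)) • ∑ i, a k i • U i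

/-- `W^d = span {ψ_1, …, ψ_d}`. -/
def podSpace {l : ℕ} (ψ : Fin l → ℝ × ℝ → ℝ) (d : ℕ) : Submodule ℝ (ℝ × ℝ → ℝ) :=
  Submodule.span ℝ {w | ∃ k : Fin l, (k : ℕ) < d ∧ w = ψ k}

/-- `w` is a Ritz projection of `U` onto `W`. -/
def IsRitz (α β : ℝ) (W : Submodule ℝ (ℝ × ℝ → ℝ)) (U w : ℝ × ℝ → ℝ) : Prop :=
  w ∈ W ∧ ∀ v ∈ W, form α β w v = form α β U v

end

end FracPOD

/-!
The bilinear form `a` is coercive with constant one: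
`‖₀D_x^{α/2} v‖² + ‖₀D_y^{β/2} v‖² ≤ a(v,v)`. Given this, the error bound is linear algebra. The POD
basis is `a`-orthonormal (`pod_orthonormal`), and because it has as many elements as the dimension of
the span of the snapshots it expands them, `U_i = ∑ k, √(L λ_k) a^k_i ψ_k` (`snapshot_eq_sum`). The
Ritz projection is the Fourier sum over the first `d` modes (`ritz_iff`), so the mean of the energies
`a(U_i - P U_i, U_i - P U_i)` is exactly the sum of the discarded eigenvalues
(`sum_bilin_pod_error`).

For the analysis, a finite element function is polynomial on each closed triangle and zero off the
open square, hence Lipschitz on the whole plane (`lipschitzWith_of_closed_cover`,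
`feSpace_subset_lipZero`). On a line, the Riemann-Liouville derivatives of order `μ` of a
Lipschitz `g` vanishing off `(0,1)` are, up to the factors `± 1 / Γ(1-μ)`, the Abel transforms
`L(x) = ∫ (x-a)₊^{-μ} g'(a) da` and `R(x) = ∫ (a-x)₊^{-μ} g'(a) da` of the bounded function `g'`
(`rlLeft_eq`, `rlRight_eq`). They are therefore bounded and linear in `g`, so that `a` is a bilinear
form on the space `lipZero` of Lipschitz functions vanishing off the square.

Coercivity needs no Fourier transform. For `1/2 < μ < 1` Fubini's theorem expresses both
`∫_ℝ L R` and `∫_ℝ L²` through the energy `∬ |a-b|^{1-2μ} g'(a) g'(b)`, with Beta function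
coefficients; `1/2 < μ` makes the second inner integral converge at infinity. Euler's reflection
formula gives the ratio of the coefficients (`crossConst_eq`), and
`∫_ℝ L R = -cos(πμ) ∫_ℝ L²` (`integral_abel_products`). As `L R` vanishes off `(0,1)`, the
factor `1 / cos(πμ)`, which is twice the constant of the form, turns `∫₀¹ ₀D^μ g · D₁^μ g` into
`∫_ℝ (₀D^μ g)²`, at least its restriction to `(0,1)` (`integral_rlLeft_sq_le`).
-/

namespace FracPOD

noncomputable section

open MeasureTheory Set Filter Topology
open scoped NNReal

/-! ### Riemann-Liouville derivatives of Lipschitz functions -/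

/-- The one-sided power kernel `s ↦ s₊^{-μ}`. -/
def powKer (μ : ℝ) : ℝ → ℝ := (Ioi 0).indicator fun s => s ^ (-μ)

lemma powKer_of_pos {μ s : ℝ} (hs : 0 < s) : powKer μ s = s ^ (-μ) :=
  indicator_of_mem (s := Ioi (0 : ℝ)) hs _

lemma powKer_of_nonpos {μ s : ℝ} (hs : s ≤ 0) : powKer μ s = 0 :=
  indicator_of_notMem (s := Ioi (0 : ℝ)) (not_lt.2 hs) _

lemma powKer_nonneg (μ s : ℝ) : 0 ≤ powKer μ s :=
  indicator_nonneg (fun _ hx => Real.rpow_nonneg (le_of_lt hx) _) s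

lemma measurable_powKer (μ : ℝ) : Measurable (powKer μ) :=
  (measurable_id.pow_const (-μ)).indicator measurableSet_Ioi

lemma powKer_mul {μ c : ℝ} (hc : 0 < c) (s : ℝ) : powKer μ (c * s) = c ^ (-μ) * powKer μ s := by
  rcases le_or_gt s 0 with hs | hs
  · rw [powKer_of_nonpos hs, powKer_of_nonpos (mul_nonpos_of_nonneg_of_nonpos hc.le hs), mul_zero]
  · rw [powKer_of_pos hs, powKer_of_pos (mul_pos hc hs), Real.mul_rpow hc.le hs.le]

/-- Left-sided Abel transform `∫ (x - a)₊^{-μ} h(a) da`. -/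
def abelLeft (μ : ℝ) (h : ℝ → ℝ) (x : ℝ) : ℝ := ∫ a, powKer μ (x - a) * h a

/-- Right-sided Abel transform `∫ (a - x)₊^{-μ} h(a) da`. -/
def abelRight (μ : ℝ) (h : ℝ → ℝ) (x : ℝ) : ℝ := ∫ a, powKer μ (a - x) * h a

lemma integrableOn_rpow_neg {μ : ℝ} (hμ : μ < 1) {M : ℝ} (hM : 0 ≤ M) :
    IntegrableOn (fun t : ℝ => t ^ (-μ)) (Ioc 0 M) :=
  (intervalIntegrable_iff_integrableOn_Ioc_of_le hM).1
    (intervalIntegral.intervalIntegrable_rpow' (by linarith))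

lemma integral_rl_eq {μ : ℝ} {g : ℝ → ℝ} (hg0 : ∀ x, x ∉ Ioo (0 : ℝ) 1 → g x = 0) {s M : ℝ}
    (hs : s ≤ M) :
    ∫ ξ in (0 : ℝ)..s, (s - ξ) ^ (-μ) * g ξ = ∫ t in Ioc 0 M, t ^ (-μ) * g (s - t) := by
  have hzero : ∀ x ≤ 0, g x = 0 := fun x hx => hg0 x fun h => absurd h.1 (not_lt.2 hx)
  rcases le_or_gt s 0 with h | h
  · rw [intervalIntegral.integral_symm, intervalIntegral.integral_of_le h,
      setIntegral_eq_zero_of_forall_eq_zero, setIntegral_eq_zero_of_forall_eq_zero, neg_zero]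
    · intro t ht; rw [hzero _ (by linarith [ht.1]), mul_zero]
    · intro t ht; rw [hzero _ ht.2, mul_zero]
  · have h1 := intervalIntegral.integral_comp_sub_left (a := 0) (b := s)
      (fun t => t ^ (-μ) * g (s - t)) s
    simp only [sub_sub_cancel, sub_self, sub_zero] at h1
    rw [h1, intervalIntegral.integral_of_le h.le]
    refine (setIntegral_eq_of_subset_of_forall_sdiff_eq_zero measurableSet_Ioc
      (Ioc_subset_Ioc_right hs) ?_).symm
    intro t ht
    have : s < t := by by_contra hc; exact ht.2 ⟨ht.1.1, not_lt.1 hc⟩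
    rw [hzero _ (by linarith), mul_zero]

lemma deriv_eq_zero_of_off {g : ℝ → ℝ} (hg0 : ∀ x, x ∉ Ioo (0 : ℝ) 1 → g x = 0) {x : ℝ}
    (hx : x ∉ Icc (0 : ℝ) 1) : deriv g x = 0 := by
  have : g =ᶠ[𝓝 x] fun _ => 0 := by
    filter_upwards [isClosed_Icc.isOpen_compl.mem_nhds hx] with y hy
    exact hg0 y fun h => hy (Ioo_subset_Icc_self h)
  rw [this.deriv_eq, deriv_const]

lemma abelLeft_eq {μ : ℝ} {h : ℝ → ℝ} (h0 : ∀ x, x ∉ Icc (0 : ℝ) 1 → h x = 0) {x M : ℝ}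
    (hx : x ≤ M) : abelLeft μ h x = ∫ t in Ioc 0 M, t ^ (-μ) * h (x - t) := by
  unfold abelLeft
  rw [← integral_sub_left_eq_self _ volume x]
  simp only [sub_sub_cancel]
  rw [← integral_indicator measurableSet_Ioc]
  congr 1
  ext t
  by_cases ht : t ∈ Ioc 0 M
  · rw [indicator_of_mem ht, powKer_of_pos ht.1]
  · rw [indicator_of_notMem ht]
    rcases le_or_gt t 0 with h1 | h1
    · rw [powKer_of_nonpos h1, zero_mul]
    · have : M < t := by by_contra hc; exact ht ⟨h1, not_lt.1 hc⟩
      rw [h0, mul_zero]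
      exact fun hc => absurd hc.1 (by linarith)

/-- For a Lipschitz function vanishing off `(0,1)` the fractional integral of order `1 - μ` may be
differentiated under the integral sign: the Lipschitz bound dominates the difference quotients, and
the function is differentiable almost everywhere. -/
lemma hasDerivAt_integral_rl {μ : ℝ} (hμ : μ < 1) {g : ℝ → ℝ} {K : ℝ≥0} (hg : LipschitzWith K g)
    (hg0 : ∀ x, x ∉ Ioo (0 : ℝ) 1 → g x = 0) (x : ℝ) :
    HasDerivAt (fun s => ∫ ξ in (0 : ℝ)..s, (s - ξ) ^ (-μ) * g ξ) (abelLeft μ (deriv g) x) x := by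
  set M : ℝ := |x| + 1 with hM
  have hM0 : 0 ≤ M := by positivity
  have hxM : x < M := by have := le_abs_self x; linarith
  rw [abelLeft_eq (fun y hy => deriv_eq_zero_of_off hg0 hy) hxM.le]
  have hker := integrableOn_rpow_neg hμ hM0
  have hmeas : ∀ s : ℝ, Measurable fun t : ℝ => t ^ (-μ) * g (s - t) := fun s =>
    (measurable_id.pow_const (-μ)).mul
      (hg.continuous.measurable.comp (measurable_const.sub measurable_id))
  have key := hasDerivAt_integral_of_dominated_loc_of_lip (μ := volume.restrict (Ioc 0 M))
    (F := fun s t => t ^ (-μ) * g (s - t)) (F' := fun t => t ^ (-μ) * deriv g (x - t))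
    (bound := fun t => K * t ^ (-μ)) (s := univ) (x₀ := x) univ_mem
    (Eventually.of_forall fun s => (hmeas s).aestronglyMeasurable) ?_
    ((measurable_id.pow_const (-μ)).mul ((measurable_deriv g).comp
      (measurable_const.sub measurable_id))).aestronglyMeasurable ?_ (hker.const_mul _) ?_
  · refine key.2.congr_of_eventuallyEq ?_
    filter_upwards [Iio_mem_nhds hxM] with s hs
    exact integral_rl_eq hg0 (le_of_lt hs)
  · have hb : ∀ y, ‖g y‖ ≤ K := by
      intro y
      by_cases hy : y ∈ Ioo (0 : ℝ) 1
      · have := hg.dist_le_mul y 0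
        rw [hg0 0 (by simp), dist_zero_right, dist_zero_right, Real.norm_eq_abs y,
          abs_of_pos hy.1] at this
        exact this.trans (mul_le_of_le_one_right K.2 hy.2.le)
      · rw [hg0 y hy, norm_zero]; exact K.2
    exact Integrable.mul_bdd (c := K) hker
      (hg.continuous.comp (continuous_const.sub continuous_id)).aestronglyMeasurable
      (Eventually.of_forall fun t => hb _)
  · filter_upwards [ae_restrict_mem measurableSet_Ioc] with t ht
    refine LipschitzOnWith.of_dist_le_mul fun s _ s' _ => ?_
    have h1 := hg.dist_le_mul (s - t) (s' - t)
    have h2 : 0 ≤ t ^ (-μ) := Real.rpow_nonneg ht.1.le _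
    rw [dist_sub_right] at h1
    rw [Real.dist_eq, ← mul_sub, abs_mul, abs_of_nonneg h2, ← Real.dist_eq, Real.coe_nnabs,
      abs_of_nonneg (mul_nonneg K.coe_nonneg h2)]
    calc _ ≤ t ^ (-μ) * (K * dist s s') := by gcongr
      _ = _ := by ring
  · refine ae_restrict_of_ae ?_
    have := (Measure.measurePreserving_sub_left volume x).quasiMeasurePreserving.ae
      hg.ae_differentiableAt_real
    filter_upwards [this] with t ht
    simpa using (ht.hasDerivAt.comp x ((hasDerivAt_id x).sub_const t)).const_mul (t ^ (-μ))

lemma rlLeft_eq {μ : ℝ} (hμ : μ < 1) {g : ℝ → ℝ} {K : ℝ≥0} (hg : LipschitzWith K g)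
    (hg0 : ∀ x, x ∉ Ioo (0 : ℝ) 1 → g x = 0) (x : ℝ) :
    rlLeft μ g x = 1 / Real.Gamma (1 - μ) * abelLeft μ (deriv g) x := by
  rw [rlLeft, (hasDerivAt_integral_rl hμ hg hg0 x).deriv]

/-- Reflection at the midpoint exchanges the two Riemann-Liouville derivatives. -/
lemma rlRight_eq_rlLeft (μ : ℝ) (g : ℝ → ℝ) (x : ℝ) :
    rlRight μ g x = rlLeft μ (fun t => g (1 - t)) (1 - x) := by
  have h : ∀ s : ℝ, ∫ ξ in s..(1 : ℝ), (ξ - s) ^ (-μ) * g ξ =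
      (fun r => ∫ ξ in (0 : ℝ)..r, (r - ξ) ^ (-μ) * g (1 - ξ)) (1 - s) := by
    intro s
    have h1 := intervalIntegral.integral_comp_sub_left (a := 0) (b := 1 - s)
      (fun t => (t - s) ^ (-μ) * g t) 1
    simp only [sub_sub_cancel, sub_zero] at h1
    rw [← h1]
    simp only [sub_right_comm (1 : ℝ) s]
  simp only [rlRight, h]
  rw [deriv_comp_const_sub (f := fun r => ∫ ξ in (0 : ℝ)..r, (r - ξ) ^ (-μ) * g (1 - ξ)), rlLeft]
  ring

lemma abelLeft_reflect (μ : ℝ) (h : ℝ → ℝ) (x : ℝ) :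
    abelLeft μ (fun a => h (1 - a)) (1 - x) = abelRight μ h x := by
  unfold abelLeft abelRight
  rw [← integral_sub_left_eq_self _ volume 1]
  simp only [sub_sub_sub_cancel_left, sub_sub_cancel]

lemma rlRight_eq {μ : ℝ} (hμ : μ < 1) {g : ℝ → ℝ} {K : ℝ≥0} (hg : LipschitzWith K g)
    (hg0 : ∀ x, x ∉ Ioo (0 : ℝ) 1 → g x = 0) (x : ℝ) :
    rlRight μ g x = -(1 / Real.Gamma (1 - μ)) * abelRight μ (deriv g) x := by
  have hr : LipschitzWith K fun t : ℝ => g (1 - t) := by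
    refine LipschitzWith.of_dist_le_mul fun s t => ?_
    have := hg.dist_le_mul (1 - s) (1 - t)
    rwa [dist_sub_left] at this
  rw [rlRight_eq_rlLeft, rlLeft_eq hμ hr, ← abelLeft_reflect]
  · have : deriv (fun t : ℝ => g (1 - t)) = fun t => -deriv g (1 - t) := by
      ext t; rw [deriv_comp_const_sub]
    rw [this]
    simp only [abelLeft, mul_neg, integral_neg, neg_mul]
  · intro t ht
    exact hg0 _ fun h => ht ⟨by linarith [h.2], by linarith [h.1]⟩

/-! ### Beta integrals of the power kernel -/

lemma beta_integral_powKer {p q : ℝ} (hp : p < 1) (hq : q < 1) :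
    Integrable (fun u => powKer p u * powKer q (1 - u)) ∧
      ∫ u, powKer p u * powKer q (1 - u) =
        Real.Gamma (1 - p) * Real.Gamma (1 - q) / Real.Gamma (2 - p - q) := by
  have hp' : (0 : ℝ) < 1 - p := by linarith
  have hq' : (0 : ℝ) < 1 - q := by linarith
  set F : ℝ → ℂ := fun x =>
    (x : ℂ) ^ (((1 - p : ℝ) : ℂ) - 1) * (1 - (x : ℂ)) ^ (((1 - q : ℝ) : ℂ) - 1)
  have hF : IntegrableOn F (Ioc 0 1) := (intervalIntegrable_iff_integrableOn_Ioc_of_le zero_le_one).1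
    (Complex.betaIntegral_convergent (by simpa using hp') (by simpa using hq'))
  have hsupp : ∀ u, u ∉ Ioo (0 : ℝ) 1 → powKer p u * powKer q (1 - u) = 0 := by
    intro u hu
    rcases le_or_gt u 0 with h | h
    · rw [powKer_of_nonpos h, zero_mul]
    · have : 1 ≤ u := by by_contra hc; exact hu ⟨h, not_le.1 hc⟩
      rw [powKer_of_nonpos (by linarith : 1 - u ≤ 0), mul_zero]
  have heq : ∀ u ∈ Ioo (0 : ℝ) 1, F u = ((powKer p u * powKer q (1 - u) : ℝ) : ℂ) := by
    intro u hu
    have h1 : 0 < 1 - u := by linarith [hu.2]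
    rw [powKer_of_pos hu.1, powKer_of_pos h1]
    push_cast
    rw [Complex.ofReal_cpow hu.1.le, Complex.ofReal_cpow h1.le]
    simp [F]
  rw [integrableOn_Ioc_iff_integrableOn_Ioo] at hF
  constructor
  · rw [← integrableOn_iff_integrable_of_support_subset (s := Ioo (0 : ℝ) 1)
      (fun u hu => by by_contra hc; exact hu (hsupp u hc))]
    refine hF.re.congr ?_
    filter_upwards [ae_restrict_mem measurableSet_Ioo] with u hu
    rw [heq u hu]
    simp
  · have h1 := Complex.betaIntegral_eq_Gamma_mul_div ((1 - p : ℝ) : ℂ) ((1 - q : ℝ) : ℂ)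
      (by simpa using hp') (by simpa using hq')
    have h2 : Complex.betaIntegral ((1 - p : ℝ) : ℂ) ((1 - q : ℝ) : ℂ) = ∫ x in Ioo (0 : ℝ) 1, F x := by
      rw [Complex.betaIntegral, intervalIntegral.integral_of_le zero_le_one,
        integral_Ioc_eq_integral_Ioo]
    rw [h2, setIntegral_congr_fun measurableSet_Ioo heq, integral_complex_ofReal,
      setIntegral_eq_integral_of_forall_compl_eq_zero hsupp, ← Complex.ofReal_add,
      Complex.Gamma_ofReal, Complex.Gamma_ofReal, Complex.Gamma_ofReal] at h1
    rw [show 2 - p - q = 1 - p + (1 - q) by ring]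
    exact_mod_cast h1

/-- The substitution `v = w⁻¹` turns this infinite integral into a Beta integral; it converges at
infinity because `1 < 2 μ`. -/
lemma integral_powKer_sub_one {μ : ℝ} (hμ : 1 / 2 < μ) (hμ' : μ < 1) :
    Integrable (fun v => powKer μ (v - 1) * powKer μ v) ∧
      ∫ v, powKer μ (v - 1) * powKer μ v =
        Real.Gamma (2 * μ - 1) * Real.Gamma (1 - μ) / Real.Gamma μ := by
  obtain ⟨h1, h2⟩ := beta_integral_powKer (p := 2 - 2 * μ) (q := μ) (by linarith) hμ'
  have hs1 : ∀ v, v ∉ Ioi (0 : ℝ) → powKer μ (v - 1) * powKer μ v = 0 := fun v hv => by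
    rw [powKer_of_nonpos (not_lt.1 hv), mul_zero]
  have hs2 : ∀ v, v ∉ Ioi (0 : ℝ) → powKer (2 - 2 * μ) v * powKer μ (1 - v) = 0 := fun v hv => by
    rw [powKer_of_nonpos (not_lt.1 hv), zero_mul]
  have heq : ∀ w ∈ Ioi (0 : ℝ), powKer (2 - 2 * μ) w * powKer μ (1 - w) =
      (|(-1 : ℝ)| * w ^ ((-1 : ℝ) - 1)) • (powKer μ (w ^ (-1 : ℝ) - 1) * powKer μ (w ^ (-1 : ℝ))) := by
    intro w hw
    have hw : (0 : ℝ) < w := hw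
    rw [Real.rpow_neg_one, show w⁻¹ - 1 = w⁻¹ * (1 - w) by field_simp, powKer_mul (inv_pos.2 hw),
      powKer_of_pos hw, powKer_of_pos (inv_pos.2 hw), Real.inv_rpow hw.le, ← Real.rpow_neg hw.le,
      smul_eq_mul, abs_neg, abs_one, one_mul, neg_neg,
      show -(2 - 2 * μ) = (-1 - 1) + μ + μ by ring, Real.rpow_add hw, Real.rpow_add hw]
    ring
  have hp : (-1 : ℝ) ≠ 0 := by norm_num
  constructor
  · rw [← integrableOn_iff_integrable_of_support_subset (s := Ioi (0 : ℝ))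
      (fun u hu => by by_contra hc; exact hu (hs1 u hc)),
      ← integrableOn_Ioi_comp_rpow_iff _ hp]
    exact (integrableOn_congr_fun heq measurableSet_Ioi).1 h1.integrableOn
  · rw [← setIntegral_eq_integral_of_forall_compl_eq_zero hs1, ← integral_comp_rpow_Ioi _ hp,
      ← setIntegral_congr_fun measurableSet_Ioi heq,
      setIntegral_eq_integral_of_forall_compl_eq_zero hs2, h2]
    congr 2 <;> ring_nf

/-- `∫ u₊^{-μ} (1 - u)₊^{-μ} du`. -/
def crossConst (μ : ℝ) : ℝ := ∫ u, powKer μ u * powKer μ (1 - u)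

/-- `∫ (v - 1)₊^{-μ} v₊^{-μ} dv`. -/
def squareConst (μ : ℝ) : ℝ := ∫ v, powKer μ (v - 1) * powKer μ v

/-- Euler's reflection formula at `μ` and at `2 μ - 1` produces the factor `cos (π μ)` of the
bilinear form. -/
lemma crossConst_eq {μ : ℝ} (hμ : 1 / 2 < μ) (hμ' : μ < 1) :
    crossConst μ = -(2 * Real.cos (μ * Real.pi) * squareConst μ) := by
  rw [crossConst, squareConst, (beta_integral_powKer hμ' hμ').2, (integral_powKer_sub_one hμ hμ').2]
  have e1 := Real.Gamma_mul_Gamma_one_sub μ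
  have e2 := Real.Gamma_mul_Gamma_one_sub (2 * μ - 1)
  have g1 := (Real.Gamma_pos_of_pos (by linarith : 0 < μ)).ne'
  have g2 := (Real.Gamma_pos_of_pos (by linarith : 0 < 1 - (2 * μ - 1))).ne'
  have hs1 : Real.sin (Real.pi * (2 * μ - 1)) = -(2 * Real.sin (Real.pi * μ) * Real.cos (μ * Real.pi)) := by
    rw [show Real.pi * (2 * μ - 1) = 2 * (Real.pi * μ) - Real.pi by ring, Real.sin_sub_pi,
      Real.sin_two_mul, mul_comm μ]
  have hsin : 0 < Real.sin (Real.pi * μ) :=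
    Real.sin_pos_of_pos_of_lt_pi (by have := Real.pi_pos; nlinarith) (by nlinarith [Real.pi_pos])
  have hcos : Real.cos (μ * Real.pi) < 0 :=
    Real.cos_neg_of_pi_div_two_lt_of_lt (by nlinarith [Real.pi_pos]) (by nlinarith [Real.pi_pos])
  rw [hs1] at e2
  have hpi := Real.pi_pos.ne'
  rw [show 2 - μ - μ = 1 - (2 * μ - 1) by ring]
  rw [eq_div_iff hsin.ne'] at e1
  rw [eq_div_iff (by have := mul_ne_zero hsin.ne' hcos.ne; simpa [mul_assoc] using this)] at e2
  generalize Real.Gamma (1 - (2 * μ - 1)) = X at *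
  generalize Real.Gamma (2 * μ - 1) = D at *
  generalize Real.Gamma (1 - μ) = G at *
  -- `Γ(1-μ) Γ(μ)` and `-2 cos (π μ) Γ(2μ-1) Γ(2-2μ)` both equal `π / sin (π μ)`
  have key : Real.Gamma μ * G = -(2 * Real.cos (μ * Real.pi) * D * X) :=
    mul_right_cancel₀ hsin.ne' (by linear_combination e1 - e2)
  field_simp
  linear_combination G * key

/-! ### Correlations of translated power kernels -/

lemma integral_powKer_cross {μ : ℝ} (hμ' : μ < 1) (a b : ℝ) :
    Integrable (fun x => powKer μ (x - a) * powKer μ (b - x)) ∧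
      (a ≠ b → ∫ x, powKer μ (x - a) * powKer μ (b - x) =
        crossConst μ * powKer (2 * μ - 1) (b - a)) := by
  rcases le_or_gt b a with h | h
  · have : (fun x => powKer μ (x - a) * powKer μ (b - x)) = fun _ => 0 := by
      ext x
      rcases le_or_gt x a with hx | hx
      · rw [powKer_of_nonpos (by linarith : x - a ≤ 0), zero_mul]
      · rw [powKer_of_nonpos (by linarith : b - x ≤ 0), mul_zero]
    rw [this, powKer_of_nonpos (by linarith : b - a ≤ 0)]
    simp
  · have hc : 0 < b - a := by linarith
    set c := b - a
    have e : ∀ x, powKer μ (x - a) * powKer μ (b - x) =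
        (fun y => c ^ (-μ) * c ^ (-μ) * (powKer μ (c⁻¹ * y) * powKer μ (1 - c⁻¹ * y))) (x - a) := by
      intro x
      have h1 : x - a = c * (c⁻¹ * (x - a)) := by field_simp
      have h2 : b - x = c * (1 - c⁻¹ * (x - a)) := by field_simp; simp [c]
      conv_lhs => rw [h1, h2, powKer_mul hc, powKer_mul hc]
      ring
    simp only [e]
    constructor
    · exact ((((beta_integral_powKer hμ' hμ').1.comp_mul_left'
        (inv_ne_zero hc.ne')).const_mul _).comp_sub_right a)
    · intro _
      refine (integral_sub_right_eq_self (μ := volume) (fun y => c ^ (-μ) * c ^ (-μ) *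
        (powKer μ (c⁻¹ * y) * powKer μ (1 - c⁻¹ * y))) a).trans ?_
      rw [integral_const_mul,
        Measure.integral_comp_mul_left (fun u => powKer μ u * powKer μ (1 - u)), powKer_of_pos hc,
        inv_inv, abs_of_pos hc, smul_eq_mul, ← crossConst,
        show -(2 * μ - 1) = -μ + -μ + 1 by ring, Real.rpow_add hc, Real.rpow_add hc, Real.rpow_one]
      ring

lemma integral_powKer_square_of_lt {μ : ℝ} (hμ : 1 / 2 < μ) (hμ' : μ < 1) {a b : ℝ} (h : a < b) :
    Integrable (fun x => powKer μ (x - a) * powKer μ (x - b)) ∧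
      ∫ x, powKer μ (x - a) * powKer μ (x - b) = squareConst μ * (b - a) ^ (-(2 * μ - 1)) := by
  have hc : 0 < b - a := by linarith
  set c := b - a
  have e : ∀ x, powKer μ (x - a) * powKer μ (x - b) =
      (fun y => c ^ (-μ) * c ^ (-μ) * (powKer μ (c⁻¹ * y - 1) * powKer μ (c⁻¹ * y))) (x - a) := by
    intro x
    have h1 : x - a = c * (c⁻¹ * (x - a)) := by field_simp
    have h2 : x - b = c * (c⁻¹ * (x - a) - 1) := by field_simp; simp [c]
    conv_lhs => rw [h1, h2, powKer_mul hc, powKer_mul hc]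
    ring
  simp only [e]
  constructor
  · exact ((((integral_powKer_sub_one hμ hμ').1.comp_mul_left'
      (inv_ne_zero hc.ne')).const_mul _).comp_sub_right a)
  · refine (integral_sub_right_eq_self (μ := volume) (fun y => c ^ (-μ) * c ^ (-μ) *
      (powKer μ (c⁻¹ * y - 1) * powKer μ (c⁻¹ * y))) a).trans ?_
    rw [integral_const_mul,
      Measure.integral_comp_mul_left (fun v => powKer μ (v - 1) * powKer μ v),
      inv_inv, abs_of_pos hc, smul_eq_mul, ← squareConst,
      show -(2 * μ - 1) = -μ + -μ + 1 by ring, Real.rpow_add hc, Real.rpow_add hc, Real.rpow_one]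
    ring

lemma integral_powKer_square {μ : ℝ} (hμ : 1 / 2 < μ) (hμ' : μ < 1) {a b : ℝ} (h : a ≠ b) :
    Integrable (fun x => powKer μ (x - a) * powKer μ (x - b)) ∧
      ∫ x, powKer μ (x - a) * powKer μ (x - b) = squareConst μ * |b - a| ^ (-(2 * μ - 1)) := by
  rcases lt_or_gt_of_ne h with h | h
  · rw [abs_of_pos (sub_pos.2 h)]
    exact integral_powKer_square_of_lt hμ hμ' h
  · rw [abs_of_neg (sub_neg.2 h), neg_sub]
    simpa only [mul_comm] using integral_powKer_square_of_lt hμ hμ' h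

/-! ### Coercivity in one variable -/

/-- Fubini's theorem for the product of two integral transforms of the same function `h`, in terms
of the correlation `M` of their kernels. -/
lemma integral_transform_mul {k₁ k₂ : ℝ → ℝ → ℝ} {h : ℝ → ℝ} {M : ℝ × ℝ → ℝ}
    (hk₁ : Measurable (Function.uncurry k₁)) (hk₂ : Measurable (Function.uncurry k₂))
    (hk₁0 : ∀ x a, 0 ≤ k₁ x a) (hk₂0 : ∀ x a, 0 ≤ k₂ x a) (hh : Measurable h)
    (hM : ∀ᵐ p : ℝ × ℝ, Integrable (fun x => k₁ x p.1 * k₂ x p.2) ∧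
      ∫ x, k₁ x p.1 * k₂ x p.2 = M p)
    (hint : Integrable fun p : ℝ × ℝ => M p * (h p.1 * h p.2)) :
    Integrable (fun x => (∫ a, k₁ x a * h a) * ∫ b, k₂ x b * h b) ∧
      ∫ x, (∫ a, k₁ x a * h a) * ∫ b, k₂ x b * h b = ∫ p : ℝ × ℝ, M p * (h p.1 * h p.2) := by
  set F : ℝ → ℝ × ℝ → ℝ := fun x p => (k₁ x p.1 * h p.1) * (k₂ x p.2 * h p.2) with hF
  have e1 : ∀ x, (∫ a, k₁ x a * h a) * ∫ b, k₂ x b * h b = ∫ p, F x p := fun x =>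
    (integral_prod_mul (fun a => k₁ x a * h a) fun b => k₂ x b * h b).symm
  have e2 : ∀ p x, F x p = (k₁ x p.1 * k₂ x p.2) * (h p.1 * h p.2) := fun p x => by
    simp only [hF]; ring
  have hFm : Measurable (Function.uncurry F) := by
    have m1 : Measurable fun z : ℝ × ℝ × ℝ => k₁ z.1 z.2.1 :=
      hk₁.comp (measurable_fst.prodMk (measurable_fst.comp measurable_snd))
    have m2 : Measurable fun z : ℝ × ℝ × ℝ => k₂ z.1 z.2.2 :=
      hk₂.comp (measurable_fst.prodMk (measurable_snd.comp measurable_snd))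
    exact (m1.mul (hh.comp (measurable_fst.comp measurable_snd))).mul
      (m2.mul (hh.comp (measurable_snd.comp measurable_snd)))
  have hFint : Integrable (Function.uncurry F) (volume.prod volume) := by
    rw [integrable_prod_iff' hFm.aestronglyMeasurable]
    constructor
    · filter_upwards [hM] with p hp
      simp only [Function.uncurry_apply_pair, e2]
      exact hp.1.mul_const _
    · refine hint.norm.congr ?_
      filter_upwards [hM] with p hp
      have hM0 : 0 ≤ M p := by
        rw [← hp.2]; exact integral_nonneg fun x => mul_nonneg (hk₁0 _ _) (hk₂0 _ _)
      simp only [Function.uncurry_apply_pair, e2, norm_mul _ (h p.1 * h p.2)]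
      rw [integral_mul_const, ← abs_of_nonneg hM0, Real.norm_eq_abs, abs_abs, ← hp.2,
        abs_of_nonneg (integral_nonneg fun x => mul_nonneg (hk₁0 _ _) (hk₂0 _ _))]
      congr 2
      ext x
      exact (Real.norm_of_nonneg (mul_nonneg (hk₁0 _ _) (hk₂0 _ _))).symm
  simp only [e1]
  refine ⟨hFint.integral_prod_left, ?_⟩
  rw [integral_integral_swap hFint]
  refine integral_congr_ae ?_
  filter_upwards [hM] with p hp
  simp only [e2]
  rw [integral_mul_const, hp.2]

lemma ae_fst_ne_snd : ∀ᵐ p : ℝ × ℝ, p.1 ≠ p.2 := by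
  have hm : MeasurableSet {p : ℝ × ℝ | p.1 = p.2} := measurableSet_eq_fun measurable_fst measurable_snd
  have : (volume : Measure (ℝ × ℝ)) {p | p.1 = p.2} = 0 := by
    rw [Measure.volume_eq_prod, Measure.measure_prod_null hm]
    refine Eventually.of_forall fun x => ?_
    have : Prod.mk x ⁻¹' {p : ℝ × ℝ | p.1 = p.2} = {x} := by
      ext y; simp [eq_comm]
    simp [this]
  rw [ae_iff]
  simpa using this

lemma powKer_add_powKer_neg {r : ℝ} (hr : r ≠ 0) (t : ℝ) :
    powKer r t + powKer r (-t) = |t| ^ (-r) := by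
  rcases lt_trichotomy t 0 with h | h | h
  · rw [powKer_of_nonpos h.le, powKer_of_pos (neg_pos.2 h), abs_of_neg h, zero_add]
  · rw [h, neg_zero, powKer_of_nonpos le_rfl, abs_zero, Real.zero_rpow (neg_ne_zero.2 hr), add_zero]
  · rw [powKer_of_nonpos (neg_nonpos.2 h.le), powKer_of_pos h, abs_of_pos h, add_zero]

lemma integrable_powKer_energy {r K : ℝ} (hr : r < 1) {h : ℝ → ℝ} (hh : Measurable h)
    (hK : ∀ x, ‖h x‖ ≤ K) (h0 : ∀ x, x ∉ Icc (0 : ℝ) 1 → h x = 0) :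
    Integrable fun p : ℝ × ℝ => powKer r (p.2 - p.1) * (h p.1 * h p.2) := by
  have hhi : Integrable h := by
    rw [← integrableOn_iff_integrable_of_support_subset (s := Icc (0 : ℝ) 1)
      (fun u hu => by by_contra hc; exact hu (h0 u hc))]
    exact Measure.integrableOn_of_bounded (by simp) hh.aestronglyMeasurable
      (Eventually.of_forall hK)
  have hg : Integrable ((Ioc (0 : ℝ) 1).indicator fun t : ℝ => t ^ (-r)) :=
    (integrable_indicator_iff measurableSet_Ioc).2 (integrableOn_rpow_neg hr zero_le_one)
  have h1 := (hhi.convolution_integrand (ContinuousLinearMap.mul ℝ ℝ) hg).swap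
  have h2 := h1.bdd_mul (c := K) (f := fun p : ℝ × ℝ => h p.2)
    (hh.comp measurable_snd).aestronglyMeasurable (Eventually.of_forall fun p => hK _)
  refine h2.congr (Eventually.of_forall fun p => ?_)
  simp only [Function.comp_apply, Prod.fst_swap, Prod.snd_swap, ContinuousLinearMap.mul_apply']
  by_cases h1 : p.1 ∈ Icc (0 : ℝ) 1
  · by_cases h2 : p.2 ∈ Icc (0 : ℝ) 1
    · have : (Ioc (0 : ℝ) 1).indicator (fun t : ℝ => t ^ (-r)) (p.2 - p.1) =
          powKer r (p.2 - p.1) := by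
        rcases le_or_gt (p.2 - p.1) 0 with h | h
        · exact (indicator_of_notMem (s := Ioc (0 : ℝ) 1) (fun hc => absurd hc.1 (not_lt.2 h)) _).trans
            (powKer_of_nonpos h).symm
        · exact (indicator_of_mem (s := Ioc (0 : ℝ) 1) ⟨h, by linarith [h1.1, h2.2]⟩ _).trans
            (powKer_of_pos h).symm
      rw [this]; ring
    · simp [h0 _ h2]
  · simp [h0 _ h1]

/-- Both integrals are multiples of the energy `∬ |a - b|^{-(2μ-1)} h(a) h(b)`, the first one after
symmetrization in `a` and `b`. The equality follows without knowing the sign of the energy. -/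
lemma integral_abel_products {μ K : ℝ} (hμ : 1 / 2 < μ) (hμ' : μ < 1) {h : ℝ → ℝ}
    (hh : Measurable h) (hK : ∀ x, ‖h x‖ ≤ K) (h0 : ∀ x, x ∉ Icc (0 : ℝ) 1 → h x = 0) :
    Integrable (fun x => abelLeft μ h x * abelLeft μ h x) ∧
      ∫ x, abelLeft μ h x * abelRight μ h x =
        -Real.cos (μ * Real.pi) * ∫ x, abelLeft μ h x * abelLeft μ h x := by
  set r := 2 * μ - 1 with hr
  have hr0 : r ≠ 0 := by rw [hr]; intro h; linarith
  have hr1 : r < 1 := by rw [hr]; linarith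
  have i1 := integrable_powKer_energy hr1 hh hK h0
  have hL : Measurable (Function.uncurry fun x a : ℝ => powKer μ (x - a)) :=
    (measurable_powKer μ).comp (measurable_fst.sub measurable_snd)
  have hR : Measurable (Function.uncurry fun x a : ℝ => powKer μ (a - x)) :=
    (measurable_powKer μ).comp (measurable_snd.sub measurable_fst)
  have i2 : Integrable fun p : ℝ × ℝ => powKer r (p.1 - p.2) * (h p.1 * h p.2) := by
    refine i1.swap.congr (Eventually.of_forall fun p => ?_)
    simp only [Function.comp_apply, Prod.fst_swap, Prod.snd_swap, mul_comm (h p.2)]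
  have hsym : ∫ p : ℝ × ℝ, powKer r (p.1 - p.2) * (h p.1 * h p.2) =
      ∫ p : ℝ × ℝ, powKer r (p.2 - p.1) * (h p.1 * h p.2) := by
    rw [Measure.volume_eq_prod, ← integral_prod_swap]
    simp only [Prod.fst_swap, Prod.snd_swap, mul_comm]
  have eabs : ∀ p : ℝ × ℝ, squareConst μ * |p.2 - p.1| ^ (-r) * (h p.1 * h p.2) =
      squareConst μ * (powKer r (p.2 - p.1) * (h p.1 * h p.2)) +
        squareConst μ * (powKer r (p.1 - p.2) * (h p.1 * h p.2)) := by
    intro p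
    rw [← powKer_add_powKer_neg hr0, neg_sub]
    ring
  have sq := integral_transform_mul hL hL (fun _ _ => powKer_nonneg _ _)
    (fun _ _ => powKer_nonneg _ _) hh
    (M := fun p => squareConst μ * |p.2 - p.1| ^ (-r))
    (by filter_upwards [ae_fst_ne_snd] with p hp using integral_powKer_square hμ hμ' hp)
    (by simp only [eabs]; exact (i1.const_mul _).add (i2.const_mul _))
  have cr := integral_transform_mul hL hR (fun _ _ => powKer_nonneg _ _)
    (fun _ _ => powKer_nonneg _ _) hh
    (M := fun p => crossConst μ * powKer r (p.2 - p.1))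
    (by filter_upwards [ae_fst_ne_snd] with p hp using
          ⟨(integral_powKer_cross hμ' p.1 p.2).1, (integral_powKer_cross hμ' p.1 p.2).2 hp⟩)
    (by simpa only [mul_assoc] using i1.const_mul (crossConst μ))
  refine ⟨sq.1, ?_⟩
  have e1 := sq.2
  have e2 := cr.2
  simp only [eabs] at e1
  rw [integral_add (i1.const_mul _) (i2.const_mul _), integral_const_mul, integral_const_mul,
    hsym] at e1
  simp only [mul_assoc] at e2
  rw [integral_const_mul, crossConst_eq hμ hμ'] at e2
  unfold abelLeft abelRight
  rw [e1, e2]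
  ring

/-- Coercivity on an interval: `∫₀¹ ₀D^μ g · D₁^μ g = cos (π μ) ∫_ℝ (₀D^μ g)²`, and the right-hand
integral only decreases when it is restricted to `(0,1)`. -/
lemma integral_rlLeft_sq_le {μ : ℝ} (hμ : 1 / 2 < μ) (hμ' : μ < 1) {g : ℝ → ℝ} {K : ℝ≥0}
    (hg : LipschitzWith K g) (hg0 : ∀ x, x ∉ Ioo (0 : ℝ) 1 → g x = 0) :
    ∫ x in Ioo (0 : ℝ) 1, rlLeft μ g x ^ 2 ≤
      1 / Real.cos (μ * Real.pi) * ∫ x in Ioo (0 : ℝ) 1, rlLeft μ g x * rlRight μ g x := by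
  have h0 : ∀ x, x ∉ Icc (0 : ℝ) 1 → deriv g x = 0 := fun x hx => deriv_eq_zero_of_off hg0 hx
  obtain ⟨hint, hcross⟩ := integral_abel_products hμ hμ' (measurable_deriv g)
    (fun x => norm_deriv_le_of_lipschitz hg) h0
  have hcos : Real.cos (μ * Real.pi) < 0 :=
    Real.cos_neg_of_pi_div_two_lt_of_lt (by nlinarith [Real.pi_pos]) (by nlinarith [Real.pi_pos])
  have hoff : ∀ x, x ∉ Ioo (0 : ℝ) 1 → abelLeft μ (deriv g) x * abelRight μ (deriv g) x = 0 := by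
    intro x hx
    by_cases hx0 : x ≤ 0
    · have : abelLeft μ (deriv g) x = 0 := by
        refine integral_eq_zero_of_ae (Eventually.of_forall fun a => ?_)
        rcases le_or_gt x a with h | h
        · simp [powKer_of_nonpos (sub_nonpos.2 h)]
        · simp [h0 a fun hc => absurd hc.1 (by linarith)]
      rw [this, zero_mul]
    · have hx1 : 1 ≤ x := by by_contra hc; exact hx ⟨not_le.1 hx0, not_le.1 hc⟩
      have : abelRight μ (deriv g) x = 0 := by
        refine integral_eq_zero_of_ae (Eventually.of_forall fun a => ?_)
        rcases le_or_gt a x with h | h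
        · simp [powKer_of_nonpos (sub_nonpos.2 h)]
        · simp [h0 a fun hc => absurd hc.2 (by linarith)]
      rw [this, mul_zero]
  set G := 1 / Real.Gamma (1 - μ)
  have e1 : ∀ x, rlLeft μ g x ^ 2 = G ^ 2 * (abelLeft μ (deriv g) x * abelLeft μ (deriv g) x) :=
    fun x => by rw [rlLeft_eq hμ' hg hg0]; ring
  have e2 : ∀ x, rlLeft μ g x * rlRight μ g x =
      -G ^ 2 * (abelLeft μ (deriv g) x * abelRight μ (deriv g) x) :=
    fun x => by rw [rlLeft_eq hμ' hg hg0, rlRight_eq hμ' hg hg0]; ring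
  simp only [e1, e2]
  rw [integral_const_mul, integral_const_mul,
    setIntegral_eq_integral_of_forall_compl_eq_zero hoff, hcross]
  have hle : ∫ x in Ioo (0 : ℝ) 1, abelLeft μ (deriv g) x * abelLeft μ (deriv g) x ≤
      ∫ x, abelLeft μ (deriv g) x * abelLeft μ (deriv g) x :=
    setIntegral_le_integral hint (Eventually.of_forall fun x => mul_self_nonneg _)
  calc _ ≤ G ^ 2 * ∫ x, abelLeft μ (deriv g) x * abelLeft μ (deriv g) x := by gcongr
    _ = _ := by
      have := hcos.ne
      field_simp

/-! ### Finite element functions are Lipschitz -/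

/-- A function that is `K`-Lipschitz on each member of a finite closed cover of a normed space is
`K`-Lipschitz: near a point only the members containing it matter, so every difference quotient
along a segment is eventually at most `K`, and the mean value inequality applies. -/
lemma lipschitzWith_of_closed_cover {E ι : Type*} [NormedAddCommGroup E] [NormedSpace ℝ E]
    [Finite ι] {F : ι → Set E} (hF : ∀ i, IsClosed (F i)) (hcov : ∀ x, ∃ i, x ∈ F i) {v : E → ℝ}
    {K : ℝ≥0} (hv : ∀ i, LipschitzOnWith K v (F i)) : LipschitzWith K v := by
  have hloc : ∀ x, ∀ᶠ y in 𝓝 x, dist (v y) (v x) ≤ K * dist y x := by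
    intro x
    have : ∀ᶠ y in 𝓝 x, ∀ i, y ∈ F i → dist (v y) (v x) ≤ K * dist y x := by
      rw [eventually_all]
      intro i
      by_cases hx : x ∈ F i
      · exact Eventually.of_forall fun y hy => (hv i).dist_le_mul y hy x hx
      · filter_upwards [(hF i).isOpen_compl.mem_nhds hx] with y hy hy' using absurd hy' hy
    filter_upwards [this] with y hy
    obtain ⟨i, hi⟩ := hcov y
    exact hy i hi
  have hcont : Continuous v := by
    rw [continuous_iff_continuousAt]
    intro x
    rw [ContinuousAt, tendsto_iff_dist_tendsto_zero]
    refine squeeze_zero' (Eventually.of_forall fun _ => dist_nonneg) (hloc x) ?_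
    have : Tendsto (fun y => (K : ℝ) * dist y x) (𝓝 x) (𝓝 (K * dist x x)) :=
      (continuous_const.mul (continuous_id.dist continuous_const)).tendsto x
    simpa using this
  have key : ∀ p q : E, v q - v p ≤ K * dist q p := by
    intro p q
    set γ : ℝ → E := fun t => p + t • (q - p) with hγ
    have hγc : Continuous γ := by fun_prop
    have hd : ∀ s t, dist (γ s) (γ t) = |s - t| * dist q p := by
      intro s t
      rw [hγ, dist_add_left, dist_eq_norm, ← sub_smul, norm_smul, Real.norm_eq_abs,
        dist_eq_norm q p]
    have h1 := image_le_of_liminf_slope_right_le_deriv_boundary (f := fun t => v (γ t)) (a := 0)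
      (b := 1) (hcont.comp hγc).continuousOn (B := fun t => v p + K * dist q p * t)
      (B' := fun _ => K * dist q p) (by simp [hγ]) (by fun_prop)
      (fun x _ => by
        simpa using (((hasDerivAt_id x).const_mul (K * dist q p)).const_add (v p)).hasDerivWithinAt)
      (fun x _ r hr => by
        refine Eventually.frequently ?_
        filter_upwards [(hγc.tendsto x).eventually (hloc (γ x)) |>.filter_mono nhdsWithin_le_nhds,
          self_mem_nhdsWithin] with z hz hxz
        have hxz : 0 < z - x := sub_pos.2 hxz
        rw [hd, abs_of_pos hxz, Real.dist_eq] at hz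
        rw [slope_def_field]
        refine lt_of_le_of_lt ?_ hr
        rw [div_le_iff₀ hxz]
        calc v (γ z) - v (γ x) ≤ |v (γ z) - v (γ x)| := le_abs_self _
          _ ≤ _ := hz
          _ = _ := by ring)
      (right_mem_Icc.2 zero_le_one)
    simp only [hγ, one_smul, add_sub_cancel, mul_one] at h1
    linarith
  refine LipschitzWith.of_dist_le_mul fun p q => ?_
  rw [Real.dist_eq, abs_le]
  have := key p q
  have := key q p
  rw [dist_comm p q] at *
  constructor <;> linarith

/-- The space of Lipschitz functions on the plane that vanish off `Ω`. -/
def lipZero : Submodule ℝ (ℝ × ℝ → ℝ) where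
  carrier := {v | (∃ K : ℝ≥0, LipschitzWith K v) ∧ ∀ p, p ∉ Omega → v p = 0}
  add_mem' := by
    rintro v w ⟨⟨K, hK⟩, h⟩ ⟨⟨K', hK'⟩, h'⟩
    exact ⟨⟨_, hK.add hK'⟩, fun p hp => by simp [h p hp, h' p hp]⟩
  zero_mem' := ⟨⟨0, LipschitzWith.const 0⟩, fun _ _ => rfl⟩
  smul_mem' := by
    rintro c v ⟨⟨K, hK⟩, h⟩
    exact ⟨⟨_, (lipschitzWith_smul c).comp hK⟩, fun p hp => by simp [h p hp]⟩

lemma isOpen_Omega : IsOpen Omega := isOpen_Ioo.prod isOpen_Ioo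

/-- On the closed elements a finite element function is polynomial, off `Ω` it is zero, and these
closed sets cover the plane. -/
lemma feSpace_subset_lipZero {α β : ℝ} {m : ℕ} {Th : Finset (Finset (ℝ × ℝ))}
    (hTh : IsTriangulation Th) {v : ℝ × ℝ → ℝ} (hv : v ∈ feSpace α β m Th) : v ∈ lipZero := by
  have hcpt : ∀ s : Finset (ℝ × ℝ), IsCompact (convexHull ℝ (s : Set (ℝ × ℝ))) := fun s =>
    s.finite_toSet.isCompact_convexHull ℝ
  have hlip : ∀ s : Th, ∃ K : ℝ≥0,
      LipschitzOnWith K v (convexHull ℝ ((s : Finset (ℝ × ℝ)) : Set (ℝ × ℝ))) := by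
    intro s
    obtain ⟨q, -, hq⟩ := hv.poly s s.2
    have hc : ContDiff ℝ 1 fun p : ℝ × ℝ => MvPolynomial.eval ![p.1, p.2] q := by
      have h1 : ContDiff ℝ 1 fun x : Fin 2 → ℝ => MvPolynomial.eval x q :=
        (AnalyticOnNhd.eval_mvPolynomial q).contDiff
      refine h1.comp (contDiff_pi.2 fun i => ?_)
      fin_cases i
      · exact contDiff_fst
      · exact contDiff_snd
    obtain ⟨K, hK⟩ := (hc.locallyLipschitz.locallyLipschitzOn
      (s := convexHull ℝ ((s : Finset (ℝ × ℝ)) : Set (ℝ × ℝ)))).exists_lipschitzOnWith_of_compact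
      (hcpt s)
    exact ⟨K, fun x hx y hy => by rw [hq x hx, hq y hy]; exact hK hx hy⟩
  choose K hK using hlip
  refine ⟨⟨Finset.univ.sup K, ?_⟩, hv.zero_off⟩
  refine lipschitzWith_of_closed_cover (ι := Option Th)
    (F := fun i => i.elim Omegaᶜ fun s => convexHull ℝ ((s : Finset (ℝ × ℝ)) : Set (ℝ × ℝ)))
    ?_ ?_ ?_
  · rintro (_ | s)
    · exact isOpen_Omega.isClosed_compl
    · exact (hcpt s).isClosed
  · intro p
    by_cases hp : p ∈ Omega
    · have : p ∈ ⋃ s ∈ Th, convexHull ℝ (s : Set (ℝ × ℝ)) := by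
        rw [hTh.cover]; exact subset_closure hp
      simp only [mem_iUnion] at this
      obtain ⟨s, hs, hps⟩ := this
      exact ⟨some ⟨s, hs⟩, hps⟩
    · exact ⟨none, hp⟩
  · rintro (_ | s)
    · refine LipschitzOnWith.of_dist_le_mul fun p hp q hq => ?_
      rw [hv.zero_off p hp, hv.zero_off q hq, dist_self]
      positivity
    · exact (hK s).weaken (Finset.le_sup (Finset.mem_univ s))

/-! ### Fractional derivatives of functions in `lipZero` -/

lemma comp_mem_lipZero {v : ℝ × ℝ → ℝ} (hv : v ∈ lipZero) {φ : ℝ × ℝ → ℝ × ℝ}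
    (hφ : LipschitzWith 1 φ) (hφ' : ∀ p, φ p ∈ Omega → p ∈ Omega) : v ∘ φ ∈ lipZero := by
  obtain ⟨⟨K, hK⟩, h0⟩ := hv
  exact ⟨⟨_, hK.comp hφ⟩, fun p hp => h0 _ fun h => hp (hφ' p h)⟩

lemma comp_swap_mem_lipZero {v : ℝ × ℝ → ℝ} (hv : v ∈ lipZero) : v ∘ Prod.swap ∈ lipZero :=
  comp_mem_lipZero hv (LipschitzWith.of_dist_le_mul fun p q => by
    simp [Prod.dist_eq, max_comm]) fun _ h => ⟨h.2, h.1⟩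

/-- Reflection of the second variable at `1/2`. -/
def reflY (p : ℝ × ℝ) : ℝ × ℝ := (p.1, 1 - p.2)

lemma comp_reflY_mem_lipZero {v : ℝ × ℝ → ℝ} (hv : v ∈ lipZero) : v ∘ reflY ∈ lipZero :=
  comp_mem_lipZero hv (LipschitzWith.of_dist_le_mul fun p q => by
    simp only [Prod.dist_eq, reflY, dist_sub_left, NNReal.coe_one, one_mul, le_refl]) fun _ h =>
      ⟨h.1, by have := h.2.1; have := h.2.2; simp only [reflY] at *; constructor <;> linarith⟩

lemma leftX_eq_leftY (μ : ℝ) (v : ℝ × ℝ → ℝ) :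
    leftX μ v = leftY μ (v ∘ Prod.swap) ∘ Prod.swap := rfl

lemma rightX_eq_rightY (μ : ℝ) (v : ℝ × ℝ → ℝ) :
    rightX μ v = rightY μ (v ∘ Prod.swap) ∘ Prod.swap := rfl

lemma rightY_eq_leftY (μ : ℝ) (v : ℝ × ℝ → ℝ) :
    rightY μ v = leftY μ (v ∘ reflY) ∘ reflY := by
  ext p
  exact rlRight_eq_rlLeft μ _ _

lemma lipschitzWith_slice {v : ℝ × ℝ → ℝ} {K : ℝ≥0} (hv : LipschitzWith K v) (x : ℝ) :
    LipschitzWith K fun y => v (x, y) :=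
  LipschitzWith.of_dist_le_mul fun s t => by
    simpa [Prod.dist_eq] using hv.dist_le_mul (x, s) (x, t)

lemma slice_eq_zero {v : ℝ × ℝ → ℝ} (hv : ∀ p, p ∉ Omega → v p = 0) (x y : ℝ)
    (hy : y ∉ Ioo (0 : ℝ) 1) : v (x, y) = 0 :=
  hv _ fun h => hy h.2

lemma integrable_abelLeft {μ K : ℝ} (hμ : μ < 1) {h : ℝ → ℝ} (hh : Measurable h)
    (hK : ∀ x, ‖h x‖ ≤ K) (h0 : ∀ x, x ∉ Icc (0 : ℝ) 1 → h x = 0) (x : ℝ) :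
    Integrable fun a => powKer μ (x - a) * h a := by
  have h1 : Integrable ((Ioc (0 : ℝ) |x|).indicator fun t : ℝ => t ^ (-μ)) :=
    (integrable_indicator_iff measurableSet_Ioc).2 (integrableOn_rpow_neg hμ (abs_nonneg x))
  refine ((h1.comp_sub_left x).mul_bdd (c := K) hh.aestronglyMeasurable
    (Eventually.of_forall hK)).congr (Eventually.of_forall fun a => ?_)
  by_cases ha : a ∈ Icc (0 : ℝ) 1
  · simp only
    congr 1
    rcases le_or_gt (x - a) 0 with h | h
    · exact (indicator_of_notMem (s := Ioc (0 : ℝ) |x|) (fun hc => absurd hc.1 (not_lt.2 h)) _).trans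
        (powKer_of_nonpos h).symm
    · exact (indicator_of_mem (s := Ioc (0 : ℝ) |x|)
        ⟨h, by linarith [ha.1, le_abs_self x]⟩ _).trans (powKer_of_pos h).symm
  · simp [h0 a ha]

lemma rlLeft_add {μ : ℝ} (hμ : μ < 1) {g₁ g₂ : ℝ → ℝ} {K₁ K₂ : ℝ≥0} (hg₁ : LipschitzWith K₁ g₁)
    (hg₂ : LipschitzWith K₂ g₂) (h₁ : ∀ x, x ∉ Ioo (0 : ℝ) 1 → g₁ x = 0)
    (h₂ : ∀ x, x ∉ Ioo (0 : ℝ) 1 → g₂ x = 0) (x : ℝ) :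
    rlLeft μ (fun t => g₁ t + g₂ t) x = rlLeft μ g₁ x + rlLeft μ g₂ x := by
  rw [rlLeft_eq hμ hg₁ h₁, rlLeft_eq hμ hg₂ h₂,
    rlLeft_eq hμ (hg₁.add hg₂) fun y hy => by simp [h₁ y hy, h₂ y hy], ← mul_add]
  congr 1
  unfold abelLeft
  rw [← integral_add
    (integrable_abelLeft hμ (measurable_deriv g₁) (fun _ => norm_deriv_le_of_lipschitz hg₁)
      (fun _ hy => deriv_eq_zero_of_off h₁ hy) x)
    (integrable_abelLeft hμ (measurable_deriv g₂) (fun _ => norm_deriv_le_of_lipschitz hg₂)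
      (fun _ hy => deriv_eq_zero_of_off h₂ hy) x)]
  refine integral_congr_ae ?_
  filter_upwards [hg₁.ae_differentiableAt_real, hg₂.ae_differentiableAt_real] with a ha₁ ha₂
  rw [deriv_fun_add ha₁ ha₂, mul_add]

lemma rlLeft_const_mul (μ c : ℝ) (g : ℝ → ℝ) (x : ℝ) :
    rlLeft μ (fun t => c * g t) x = c * rlLeft μ g x := by
  simp only [rlLeft, mul_left_comm _ c, intervalIntegral.integral_const_mul]
  rw [deriv_const_mul_field]
  ring

lemma leftY_add {μ : ℝ} (hμ : μ < 1) {v w : ℝ × ℝ → ℝ} (hv : v ∈ lipZero) (hw : w ∈ lipZero) :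
    leftY μ (v + w) = leftY μ v + leftY μ w := by
  obtain ⟨⟨K, hK⟩, h⟩ := hv
  obtain ⟨⟨K', hK'⟩, h'⟩ := hw
  ext p
  exact rlLeft_add hμ (lipschitzWith_slice hK p.1) (lipschitzWith_slice hK' p.1)
    (slice_eq_zero h p.1) (slice_eq_zero h' p.1) p.2

lemma leftY_smul (μ c : ℝ) (v : ℝ × ℝ → ℝ) : leftY μ (c • v) = c • leftY μ v := by
  ext p
  exact rlLeft_const_mul μ c _ _

lemma rightY_add {μ : ℝ} (hμ : μ < 1) {v w : ℝ × ℝ → ℝ} (hv : v ∈ lipZero) (hw : w ∈ lipZero) :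
    rightY μ (v + w) = rightY μ v + rightY μ w := by
  rw [rightY_eq_leftY, rightY_eq_leftY, rightY_eq_leftY, Pi.add_comp,
    leftY_add hμ (comp_reflY_mem_lipZero hv) (comp_reflY_mem_lipZero hw), Pi.add_comp]

lemma rightY_smul (μ c : ℝ) (v : ℝ × ℝ → ℝ) : rightY μ (c • v) = c • rightY μ v := by
  rw [rightY_eq_leftY, rightY_eq_leftY, Pi.smul_comp, leftY_smul, Pi.smul_comp]

lemma leftX_add {μ : ℝ} (hμ : μ < 1) {v w : ℝ × ℝ → ℝ} (hv : v ∈ lipZero) (hw : w ∈ lipZero) :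
    leftX μ (v + w) = leftX μ v + leftX μ w := by
  rw [leftX_eq_leftY, leftX_eq_leftY, leftX_eq_leftY, Pi.add_comp,
    leftY_add hμ (comp_swap_mem_lipZero hv) (comp_swap_mem_lipZero hw), Pi.add_comp]

lemma leftX_smul (μ c : ℝ) (v : ℝ × ℝ → ℝ) : leftX μ (c • v) = c • leftX μ v := by
  rw [leftX_eq_leftY, leftX_eq_leftY, Pi.smul_comp, leftY_smul, Pi.smul_comp]

lemma rightX_add {μ : ℝ} (hμ : μ < 1) {v w : ℝ × ℝ → ℝ} (hv : v ∈ lipZero) (hw : w ∈ lipZero) :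
    rightX μ (v + w) = rightX μ v + rightX μ w := by
  rw [rightX_eq_rightY, rightX_eq_rightY, rightX_eq_rightY, Pi.add_comp,
    rightY_add hμ (comp_swap_mem_lipZero hv) (comp_swap_mem_lipZero hw), Pi.add_comp]

lemma rightX_smul (μ c : ℝ) (v : ℝ × ℝ → ℝ) : rightX μ (c • v) = c • rightX μ v := by
  rw [rightX_eq_rightY, rightX_eq_rightY, Pi.smul_comp, rightY_smul, Pi.smul_comp]

/-- Measurable and bounded on `Ω`, a class of functions in `L²(Ω)` that is evidently stable under
the symmetries of the square. -/
def BddMeas (f : ℝ × ℝ → ℝ) : Prop := Measurable f ∧ ∃ C, ∀ p ∈ Omega, ‖f p‖ ≤ C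

lemma bddMeas_leftY {μ : ℝ} (hμ : μ < 1) {v : ℝ × ℝ → ℝ} (hv : v ∈ lipZero) :
    BddMeas (leftY μ v) := by
  obtain ⟨⟨K, hK⟩, h0⟩ := hv
  have e : leftY μ v = fun p => 1 / Real.Gamma (1 - μ) *
      ∫ a, powKer μ (p.2 - a) * deriv (fun y => v (p.1, y)) a := by
    ext p
    exact rlLeft_eq hμ (lipschitzWith_slice hK p.1) (slice_eq_zero h0 p.1) p.2
  constructor
  · rw [e]
    refine Measurable.const_mul ?_ _
    have hd : Measurable fun q : ℝ × ℝ => deriv (fun y => v (q.1, y)) q.2 :=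
      measurable_deriv_with_param (f := fun x y => v (x, y)) hK.continuous
    have hm : Measurable fun z : (ℝ × ℝ) × ℝ =>
        powKer μ (z.1.2 - z.2) * deriv (fun y => v (z.1.1, y)) z.2 :=
      ((measurable_powKer μ).comp ((measurable_snd.comp measurable_fst).sub measurable_snd)).mul
        (hd.comp ((measurable_fst.comp measurable_fst).prodMk measurable_snd))
    exact (StronglyMeasurable.integral_prod_right (f := fun (p : ℝ × ℝ) a =>
      powKer μ (p.2 - a) * deriv (fun y => v (p.1, y)) a) hm.stronglyMeasurable).measurable
  · refine ⟨|1 / Real.Gamma (1 - μ)| * ∫ t in Ioc (0 : ℝ) 1, t ^ (-μ) * K, fun p hp => ?_⟩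
    have hlip := lipschitzWith_slice hK p.1
    rw [show leftY μ v p = _ from rlLeft_eq hμ hlip (slice_eq_zero h0 p.1) p.2, norm_mul,
      Real.norm_eq_abs (1 / _), abelLeft_eq
        (fun y hy => deriv_eq_zero_of_off (slice_eq_zero h0 p.1) hy) hp.2.2.le]
    refine mul_le_mul_of_nonneg_left ?_ (abs_nonneg _)
    refine norm_integral_le_of_norm_le ((integrableOn_rpow_neg hμ zero_le_one).mul_const _) ?_
    filter_upwards [ae_restrict_mem measurableSet_Ioc] with t ht
    rw [norm_mul, Real.norm_of_nonneg (Real.rpow_nonneg ht.1.le _)]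
    exact mul_le_mul_of_nonneg_left (norm_deriv_le_of_lipschitz hlip) (Real.rpow_nonneg ht.1.le _)

lemma bddMeas_rightY {μ : ℝ} (hμ : μ < 1) {v : ℝ × ℝ → ℝ} (hv : v ∈ lipZero) :
    BddMeas (rightY μ v) := by
  obtain ⟨h, C, hC⟩ := bddMeas_leftY hμ (comp_reflY_mem_lipZero hv)
  rw [rightY_eq_leftY]
  refine ⟨h.comp (measurable_fst.prodMk (measurable_const.sub measurable_snd)), C, fun p hp => ?_⟩
  refine hC _ ⟨hp.1, ?_, ?_⟩
  · have := hp.2.2; simp only [reflY]; linarith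
  · have := hp.2.1; simp only [reflY]; linarith

lemma BddMeas.comp_swap {f : ℝ × ℝ → ℝ} (hf : BddMeas f) : BddMeas (f ∘ Prod.swap) := by
  obtain ⟨h, C, hC⟩ := hf
  exact ⟨h.comp measurable_swap, C, fun p hp => hC _ ⟨hp.2, hp.1⟩⟩

lemma bddMeas_leftX {μ : ℝ} (hμ : μ < 1) {v : ℝ × ℝ → ℝ} (hv : v ∈ lipZero) :
    BddMeas (leftX μ v) :=
  (bddMeas_leftY hμ (comp_swap_mem_lipZero hv)).comp_swap

lemma bddMeas_rightX {μ : ℝ} (hμ : μ < 1) {v : ℝ × ℝ → ℝ} (hv : v ∈ lipZero) :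
    BddMeas (rightX μ v) :=
  (bddMeas_rightY hμ (comp_swap_mem_lipZero hv)).comp_swap

lemma measurableSet_Omega : MeasurableSet Omega := measurableSet_Ioo.prod measurableSet_Ioo

lemma volume_Omega_lt_top : volume Omega < ⊤ := by
  rw [Omega, Measure.volume_eq_prod, Measure.prod_prod]
  simp

lemma BddMeas.memLp {f : ℝ × ℝ → ℝ} (hf : BddMeas f) (p : ENNReal) :
    MemLp f p (volume.restrict Omega) := by
  obtain ⟨h, C, hC⟩ := hf
  have : IsFiniteMeasure (volume.restrict Omega) := ⟨by simpa using volume_Omega_lt_top⟩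
  refine MemLp.of_bound h.aestronglyMeasurable C ?_
  filter_upwards [ae_restrict_mem measurableSet_Omega] with p hp using hC p hp

lemma BddMeas.integrable_mul {f g : ℝ × ℝ → ℝ} (hf : BddMeas f) (hg : BddMeas g) :
    IntegrableOn (fun p => f p * g p) Omega :=
  (hf.memLp 2).integrable_mul (hg.memLp 2)

/-! ### The bilinear form -/

lemma ip_comm (f g : ℝ × ℝ → ℝ) : ip f g = ip g f := by
  simp only [ip, mul_comm]

lemma ip_add_left {f f' g : ℝ × ℝ → ℝ} (hf : BddMeas f) (hf' : BddMeas f') (hg : BddMeas g) :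
    ip (f + f') g = ip f g + ip f' g := by
  simp only [ip, Pi.add_apply, add_mul]
  exact integral_add (hf.integrable_mul hg) (hf'.integrable_mul hg)

lemma ip_smul_left (c : ℝ) (f g : ℝ × ℝ → ℝ) : ip (c • f) g = c * ip f g := by
  simp only [ip, Pi.smul_apply, smul_eq_mul, mul_assoc]
  exact integral_const_mul _ _

lemma ip_comp_swap (f g : ℝ × ℝ → ℝ) : ip (f ∘ Prod.swap) (g ∘ Prod.swap) = ip f g :=
  setIntegral_prod_swap (μ := volume) (ν := volume) (Ioo (0 : ℝ) 1) (Ioo (0 : ℝ) 1)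
    fun p => f p * g p

lemma normSq_eq_ip (f : ℝ × ℝ → ℝ) : normSq f = ip f f := by
  simp only [normSq, ip, sq]

/-- Coercivity on the square, by integrating the one-dimensional inequality over `x`. -/
lemma normSq_leftY_le {μ : ℝ} (hμ : 1 / 2 < μ) (hμ' : μ < 1) {v : ℝ × ℝ → ℝ} (hv : v ∈ lipZero) :
    normSq (leftY μ v) ≤ 1 / Real.cos (μ * Real.pi) * ip (leftY μ v) (rightY μ v) := by
  have hl := bddMeas_leftY hμ' hv
  have hr := bddMeas_rightY hμ' hv
  have il := hl.integrable_mul hl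
  have ir := hl.integrable_mul hr
  obtain ⟨⟨K, hK⟩, h0⟩ := hv
  rw [normSq_eq_ip, ip, ip, Omega]
  rw [Omega, Measure.volume_eq_prod] at *
  rw [setIntegral_prod _ il, setIntegral_prod _ ir, ← integral_const_mul]
  rw [IntegrableOn, ← Measure.prod_restrict] at il ir
  refine integral_mono il.integral_prod_left (ir.integral_prod_left.const_mul _) fun x => ?_
  have h := integral_rlLeft_sq_le hμ hμ' (lipschitzWith_slice hK x) (slice_eq_zero h0 x)
  simp only [sq] at h
  exact h

lemma normSq_leftX_le {μ : ℝ} (hμ : 1 / 2 < μ) (hμ' : μ < 1) {v : ℝ × ℝ → ℝ} (hv : v ∈ lipZero) :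
    normSq (leftX μ v) ≤ 1 / Real.cos (μ * Real.pi) * ip (leftX μ v) (rightX μ v) := by
  have := normSq_leftY_le hμ hμ' (comp_swap_mem_lipZero hv)
  rwa [leftX_eq_leftY, rightX_eq_rightY, normSq_eq_ip, ip_comp_swap, ip_comp_swap, ← normSq_eq_ip]

lemma form_comm (α β : ℝ) (u v : ℝ × ℝ → ℝ) : form α β u v = form α β v u := by
  simp only [form, ip_comm (leftX _ v), ip_comm (rightX _ v), ip_comm (leftY _ v),
    ip_comm (rightY _ v)]
  ring

lemma form_smul_left (α β c : ℝ) (u v : ℝ × ℝ → ℝ) : form α β (c • u) v = c * form α β u v := by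
  simp only [form, leftX_smul, rightX_smul, leftY_smul, rightY_smul, ip_smul_left]
  ring

lemma form_add_left {α β : ℝ} (hα : α < 2) (hβ : β < 2) {u w v : ℝ × ℝ → ℝ} (hu : u ∈ lipZero)
    (hw : w ∈ lipZero) (hv : v ∈ lipZero) :
    form α β (u + w) v = form α β u v + form α β w v := by
  have ha : α / 2 < 1 := by linarith
  have hb : β / 2 < 1 := by linarith
  rw [form, leftX_add ha hu hw, rightX_add ha hu hw, leftY_add hb hu hw, rightY_add hb hu hw,
    ip_add_left (bddMeas_leftX ha hu) (bddMeas_leftX ha hw) (bddMeas_rightX ha hv),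
    ip_add_left (bddMeas_rightX ha hu) (bddMeas_rightX ha hw) (bddMeas_leftX ha hv),
    ip_add_left (bddMeas_leftY hb hu) (bddMeas_leftY hb hw) (bddMeas_rightY hb hv),
    ip_add_left (bddMeas_rightY hb hu) (bddMeas_rightY hb hw) (bddMeas_leftY hb hv), form, form]
  ring

lemma normSq_add_normSq_le_form {α β : ℝ} (hα : 1 < α) (hα' : α < 2) (hβ : 1 < β) (hβ' : β < 2)
    {v : ℝ × ℝ → ℝ} (hv : v ∈ lipZero) :
    normSq (leftX (α / 2) v) + normSq (leftY (β / 2) v) ≤ form α β v v := by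
  have h1 := normSq_leftX_le (μ := α / 2) (by linarith) (by linarith) hv
  have h2 := normSq_leftY_le (μ := β / 2) (by linarith) (by linarith) hv
  have h3 : ∀ γ : ℝ, 1 / Real.cos (γ / 2 * Real.pi) = 2 * rieszConst γ := fun γ => by
    rw [rieszConst, show γ / 2 * Real.pi = γ * Real.pi / 2 by ring]
    ring
  rw [h3] at h1 h2
  rw [form, ip_comm (rightX _ v), ip_comm (rightY _ v)]
  linarith

/-- The form `a` as a bilinear form on `lipZero`. -/
def formBilin {α β : ℝ} (hα : α < 2) (hβ : β < 2) : LinearMap.BilinForm ℝ lipZero :=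
  LinearMap.mk₂ ℝ (fun u v => form α β u v)
    (fun u w v => form_add_left hα hβ u.2 w.2 v.2)
    (fun c u v => form_smul_left α β c u v)
    (fun u v w => by
      rw [form_comm α β u, form_comm α β u, form_comm α β u]
      exact form_add_left hα hβ v.2 w.2 u.2)
    (fun c u v => by
      rw [form_comm α β u, form_comm α β u]
      exact form_smul_left α β c v u)

@[simp]
lemma formBilin_apply {α β : ℝ} (hα : α < 2) (hβ : β < 2) (u v : lipZero) :
    formBilin hα hβ u v = form α β u v := rfl

/-! ### Orthonormal systems and proper orthogonal decomposition -/

section Algebra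

variable {V ι κ : Type*} [AddCommGroup V] [Module ℝ V] [Fintype κ]
  {B : LinearMap.BilinForm ℝ V} {ψ : ι → V} {U : κ → V} {s : ι → ℝ} {a : ι → κ → ℝ}

lemma bilin_snapshot_pod (hs : ∀ k, s k ≠ 0)
    (heig : ∀ k i, ∑ j, B (U i) (U j) * a k j = s k ^ 2 * a k i)
    (hψ : ∀ k, ψ k = (s k)⁻¹ • ∑ i, a k i • U i) (i : κ) (k : ι) :
    B (U i) (ψ k) = s k * a k i := by
  rw [hψ, map_smul, map_sum, smul_eq_mul]
  simp only [map_smul, smul_eq_mul, mul_comm (a k _)]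
  rw [heig]
  have := hs k
  field_simp

variable [DecidableEq ι]

lemma bilin_sum_orthonormal (hψ : ∀ j k, B (ψ j) (ψ k) = if j = k then 1 else 0) (J : Finset ι)
    (c : ι → ℝ) (k : ι) : B (∑ j ∈ J, c j • ψ j) (ψ k) = if k ∈ J then c k else 0 := by
  simp [hψ]

lemma mem_span_image_finset {J : Finset ι} {w : V} (hw : w ∈ Submodule.span ℝ (ψ '' J)) :
    ∃ c : ι → ℝ, w = ∑ k ∈ J, c k • ψ k := by
  obtain ⟨c, hc⟩ := (Submodule.mem_span_image_finset_iff_exists_fun ℝ).1 hw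
  refine ⟨fun k => if hk : k ∈ J then c ⟨k, hk⟩ else 0, ?_⟩
  rw [← hc, ← Finset.sum_coe_sort J]
  simp

/-- The Galerkin projection onto the span of a `B`-orthonormal system exists, is unique, and is
given by its Fourier sum. -/
lemma ritz_iff (hψ : ∀ j k, B (ψ j) (ψ k) = if j = k then 1 else 0) (J : Finset ι) (u w : V) :
    (w ∈ Submodule.span ℝ (ψ '' J) ∧ ∀ v ∈ Submodule.span ℝ (ψ '' J), B w v = B u v) ↔
      w = ∑ k ∈ J, B u (ψ k) • ψ k := by
  have hmem : ∀ k ∈ J, ψ k ∈ Submodule.span ℝ (ψ '' J) := fun k hk =>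
    Submodule.subset_span ⟨k, hk, rfl⟩
  constructor
  · rintro ⟨hw, h⟩
    obtain ⟨c, rfl⟩ := mem_span_image_finset hw
    refine Finset.sum_congr rfl fun k hk => ?_
    rw [← h _ (hmem k hk), bilin_sum_orthonormal hψ, if_pos hk]
  · rintro rfl
    refine ⟨Submodule.sum_mem _ fun k hk => Submodule.smul_mem _ _ (hmem k hk), fun v hv => ?_⟩
    obtain ⟨c, rfl⟩ := mem_span_image_finset hv
    rw [map_sum (B _), map_sum (B u)]
    refine Finset.sum_congr rfl fun k hk => ?_
    rw [map_smul, map_smul, bilin_sum_orthonormal hψ, if_pos hk]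

lemma bilin_self_orthonormal (hψ : ∀ j k, B (ψ j) (ψ k) = if j = k then 1 else 0) (J : Finset ι)
    (c : ι → ℝ) : B (∑ j ∈ J, c j • ψ j) (∑ j ∈ J, c j • ψ j) = ∑ j ∈ J, c j ^ 2 := by
  rw [map_sum]
  refine Finset.sum_congr rfl fun k hk => ?_
  rw [map_smul, bilin_sum_orthonormal hψ, if_pos hk, smul_eq_mul, sq]

lemma linearIndependent_of_bilin_orthonormal
    (hψ : ∀ j k, B (ψ j) (ψ k) = if j = k then 1 else 0) : LinearIndependent ℝ ψ := by
  rw [linearIndependent_iff']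
  intro J c h k hk
  have := bilin_sum_orthonormal hψ J c k
  rwa [h, map_zero, LinearMap.zero_apply, if_pos hk, eq_comm] at this

lemma pod_orthonormal (hs : ∀ k, s k ≠ 0) (ha : ∀ j k, a j ⬝ᵥ a k = if j = k then 1 else 0)
    (heig : ∀ k i, ∑ j, B (U i) (U j) * a k j = s k ^ 2 * a k i)
    (hψ : ∀ k, ψ k = (s k)⁻¹ • ∑ i, a k i • U i) (j k : ι) :
    B (ψ j) (ψ k) = if j = k then 1 else 0 := by
  have h1 : B (ψ j) (ψ k) = (s j)⁻¹ * (s k * (a j ⬝ᵥ a k)) := by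
    conv_lhs => rw [hψ j]
    simp only [map_smul, map_sum, LinearMap.smul_apply, LinearMap.sum_apply, smul_eq_mul,
      bilin_snapshot_pod hs heig hψ, dotProduct, Finset.mul_sum]
    exact Finset.sum_congr rfl fun i _ => by ring
  rw [h1, ha]
  split_ifs with h
  · rw [h, mul_one, inv_mul_cancel₀ (hs k)]
  · simp

variable [Fintype ι]

/-- Since the number of POD modes equals the dimension of the span of the snapshots, every
snapshot is a combination of the modes. -/
lemma snapshot_eq_sum (hs : ∀ k, s k ≠ 0) (ha : ∀ j k, a j ⬝ᵥ a k = if j = k then 1 else 0)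
    (heig : ∀ k i, ∑ j, B (U i) (U j) * a k j = s k ^ 2 * a k i)
    (hψ : ∀ k, ψ k = (s k)⁻¹ • ∑ i, a k i • U i)
    (hdim : Module.finrank ℝ (Submodule.span ℝ (range U)) = Fintype.card ι) (i : κ) :
    U i = ∑ k, (s k * a k i) • ψ k := by
  have hon := pod_orthonormal hs ha heig hψ
  have hle : Submodule.span ℝ (range ψ) ≤ Submodule.span ℝ (range U) := by
    rw [Submodule.span_le]
    rintro _ ⟨k, rfl⟩
    rw [hψ]
    exact Submodule.smul_mem _ _ (Submodule.sum_mem _ fun i _ =>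
      Submodule.smul_mem _ _ (Submodule.subset_span ⟨i, rfl⟩))
  have : FiniteDimensional ℝ (Submodule.span ℝ (range U)) :=
    FiniteDimensional.span_of_finite ℝ (finite_range U)
  have heq := Submodule.eq_of_le_of_finrank_eq hle
    ((finrank_span_eq_card (linearIndependent_of_bilin_orthonormal hon)).trans hdim.symm)
  have hU : U i ∈ Submodule.span ℝ (ψ '' (Finset.univ : Finset ι)) := by
    rw [Finset.coe_univ, image_univ, heq]
    exact Submodule.subset_span ⟨i, rfl⟩
  obtain ⟨c, hc⟩ := mem_span_image_finset hU
  rw [hc]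
  refine Finset.sum_congr rfl fun k _ => ?_
  rw [← bilin_snapshot_pod hs heig hψ, hc, bilin_sum_orthonormal hon, if_pos (Finset.mem_univ k)]

/-- The total energy of the snapshots in the truncated modes. -/
lemma sum_bilin_pod_error (hs : ∀ k, s k ≠ 0) (ha : ∀ j k, a j ⬝ᵥ a k = if j = k then 1 else 0)
    (heig : ∀ k i, ∑ j, B (U i) (U j) * a k j = s k ^ 2 * a k i)
    (hψ : ∀ k, ψ k = (s k)⁻¹ • ∑ i, a k i • U i)
    (hdim : Module.finrank ℝ (Submodule.span ℝ (range U)) = Fintype.card ι) (J : Finset ι) :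
    ∑ i, B (U i - ∑ k ∈ J, B (U i) (ψ k) • ψ k) (U i - ∑ k ∈ J, B (U i) (ψ k) • ψ k) =
      ∑ k ∈ Jᶜ, s k ^ 2 := by
  have hon := pod_orthonormal hs ha heig hψ
  have herr : ∀ i, U i - ∑ k ∈ J, B (U i) (ψ k) • ψ k = ∑ k ∈ Jᶜ, (s k * a k i) • ψ k := by
    intro i
    simp only [bilin_snapshot_pod hs heig hψ]
    rw [sub_eq_iff_eq_add, Finset.sum_compl_add_sum]
    exact snapshot_eq_sum hs ha heig hψ hdim i
  simp only [herr, bilin_self_orthonormal hon]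
  rw [Finset.sum_comm]
  refine Finset.sum_congr rfl fun k _ => ?_
  have := ha k k
  rw [if_pos rfl, dotProduct] at this
  simp only [mul_pow, ← Finset.mul_sum, sq (a k _)]
  rw [this, mul_one]

end Algebra

lemma podSpace_eq_map {l : ℕ} (ψ : Fin l → lipZero) (d : ℕ) :
    podSpace (fun k => (ψ k : ℝ × ℝ → ℝ)) d =
      (Submodule.span ℝ (ψ '' (Finset.univ.filter fun k : Fin l => (k : ℕ) < d))).map
        lipZero.subtype := by
  rw [podSpace, Submodule.map_span]
  congr 1
  ext w
  constructor
  · rintro ⟨k, hk, rfl⟩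
    exact ⟨ψ k, ⟨k, by simpa using hk, rfl⟩, rfl⟩
  · rintro ⟨_, ⟨k, hk, rfl⟩, rfl⟩
    exact ⟨k, by simpa using hk, rfl⟩

lemma isRitz_iff {α β : ℝ} (hα : α < 2) (hβ : β < 2) {l : ℕ} {ψ : Fin l → lipZero}
    (hψ : ∀ j k, formBilin hα hβ (ψ j) (ψ k) = if j = k then 1 else 0) (d : ℕ) (u : lipZero)
    (w : ℝ × ℝ → ℝ) :
    IsRitz α β (podSpace (fun k => (ψ k : ℝ × ℝ → ℝ)) d) u w ↔
      w = ((∑ k ∈ Finset.univ.filter (fun k : Fin l => (k : ℕ) < d),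
        formBilin hα hβ u (ψ k) • ψ k : lipZero) : ℝ × ℝ → ℝ) := by
  have key := ritz_iff hψ (Finset.univ.filter fun k : Fin l => (k : ℕ) < d) u
  rw [IsRitz, podSpace_eq_map]
  constructor
  · rintro ⟨⟨w, hw, rfl⟩, h⟩
    exact congrArg _ ((key w).1 ⟨hw, fun v hv => h v ⟨v, hv, rfl⟩⟩)
  · rintro rfl
    obtain ⟨h1, h2⟩ := (key _).2 rfl
    refine ⟨⟨_, h1, rfl⟩, ?_⟩
    rintro _ ⟨v, hv, rfl⟩
    exact h2 v hv

end

end FracPOD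

theorem theorem4p2 (α β : ℝ) (hα : 1 < α) (hα' : α < 2) (hβ : 1 < β) (hβ' : β < 2) :
    ∃ C : ℝ, 0 < C ∧
      ∀ (m : ℕ) (_ : 1 ≤ m)
        (Th : Finset (Finset (ℝ × ℝ))) (_ : FracPOD.IsTriangulation Th)
        (T : ℝ) (_ : 0 < T) (N : ℕ) (_ : 1 ≤ N)
        (f : ℝ → ℝ × ℝ → ℝ)
        (_ : ∀ n : ℕ, 1 ≤ n → n ≤ N →
          MeasureTheory.MemLp (f (n * (T / N))) 2
            (MeasureTheory.volume.restrict FracPOD.Omega))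
        (u : ℕ → ℝ × ℝ → ℝ)
        (_ : FracPOD.IsFESolution α β (FracPOD.feSpace α β m Th) T N f u)
        (L : ℕ) (idx : Fin L → ℕ) (_ : Monotone idx) (_ : ∀ i, 1 ≤ idx i ∧ idx i ≤ N)
        (l : ℕ) (lam : Fin l → ℝ) (a : Fin l → Fin L → ℝ) (ψ : Fin l → ℝ × ℝ → ℝ)
        (_ : FracPOD.IsPOD α β (fun i => u (idx i)) lam a ψ)
        (d : ℕ) (_ : 1 ≤ d) (_ : d ≤ l),
        -- the Ritz projection onto `W^d` is well defined on `X_h`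
        (∀ U ∈ FracPOD.feSpace α β m Th,
          ∃! w, FracPOD.IsRitz α β (FracPOD.podSpace ψ d) U w) ∧
        -- and it satisfies the error bound
        ∀ P : (ℝ × ℝ → ℝ) → (ℝ × ℝ → ℝ),
          (∀ U ∈ FracPOD.feSpace α β m Th,
            FracPOD.IsRitz α β (FracPOD.podSpace ψ d) U (P U)) →
          (∀ i, MeasureTheory.MemLp (FracPOD.leftX (α / 2) (u (idx i) - P (u (idx i)))) 2
                (MeasureTheory.volume.restrict FracPOD.Omega) ∧
              MeasureTheory.MemLp (FracPOD.leftY (β / 2) (u (idx i) - P (u (idx i)))) 2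
                (MeasureTheory.volume.restrict FracPOD.Omega)) ∧
          (1 / (L : ℝ)) *
                (∑ i, FracPOD.normSq (FracPOD.leftX (α / 2) (u (idx i) - P (u (idx i)))))
              + (1 / (L : ℝ)) *
                (∑ i, FracPOD.normSq (FracPOD.leftY (β / 2) (u (idx i) - P (u (idx i)))))
            ≤ C * ∑ j ∈ Finset.univ.filter (fun j : Fin l => d ≤ (j : ℕ)), lam j := by
  -- coercivity holds with constant one
  refine ⟨1, one_pos, ?_⟩
  intro m _ Th hTh T _ N _ f _ u hu L idx _ hidx l lam a ψ hpod d hd hdl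
  have hmem : ∀ i, u (idx i) ∈ FracPOD.feSpace α β m Th := fun i => hu.mem _ (hidx i).2
  set U : Fin L → FracPOD.lipZero := fun i =>
    ⟨u (idx i), FracPOD.feSpace_subset_lipZero hTh (hmem i)⟩ with hU
  -- without snapshots there are no modes, contrary to `1 ≤ d ≤ l`
  have hL : (0 : ℝ) < L := by
    rcases Nat.eq_zero_or_pos L with h | h
    · subst h
      have h1 := hpod.orthonormal ⟨0, by omega⟩ ⟨0, by omega⟩
      simp at h1
    · exact_mod_cast h
  set s : Fin l → ℝ := fun k => Real.sqrt (L * lam k) with hs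
  have hs2 : ∀ k, s k ^ 2 = L * lam k := fun k => Real.sq_sqrt (mul_pos hL (hpod.pos k)).le
  have hs0 : ∀ k, s k ≠ 0 := fun k => (Real.sqrt_pos.2 (mul_pos hL (hpod.pos k))).ne'
  obtain ⟨Ψ, hΨ⟩ : ∃ Ψ : Fin l → FracPOD.lipZero, ∀ k, Ψ k = (s k)⁻¹ • ∑ i, a k i • U i :=
    ⟨_, fun _ => rfl⟩
  have hψ : ψ = fun k => (Ψ k : ℝ × ℝ → ℝ) := by
    ext1 k
    rw [hpod.basis k, hΨ, one_div]
    simp [hU, hs]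
  set B := FracPOD.formBilin hα' hβ'
  have heig : ∀ k i, ∑ j, B (U i) (U j) * a k j = s k ^ 2 * a k i := by
    intro k i
    have h1 := congrFun (hpod.eigen k) i
    simp only [Matrix.mulVec, dotProduct, FracPOD.corrMatrix, Matrix.of_apply, Pi.smul_apply,
      smul_eq_mul] at h1
    rw [hs2, mul_assoc, ← h1, Finset.mul_sum]
    refine Finset.sum_congr rfl fun j _ => ?_
    rw [FracPOD.formBilin_apply, ← mul_assoc, mul_div_cancel₀ _ hL.ne']
  have hdim : Module.finrank ℝ (Submodule.span ℝ (Set.range U)) = Fintype.card (Fin l) := by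
    rw [Fintype.card_fin, ← hpod.dim, ← Submodule.finrank_map_subtype_eq, Submodule.map_span,
      ← Set.range_comp]
    rfl
  have hon := FracPOD.pod_orthonormal hs0 hpod.orthonormal heig hΨ
  have hritz := FracPOD.isRitz_iff hα' hβ' hon d
  rw [hψ]
  refine ⟨fun V hV => ?_, fun P hP => ?_⟩
  · exact ⟨_, (hritz ⟨V, FracPOD.feSpace_subset_lipZero hTh hV⟩ _).2 rfl,
      fun w hw => (hritz ⟨V, FracPOD.feSpace_subset_lipZero hTh hV⟩ w).1 hw⟩
  · set J := Finset.univ.filter fun k : Fin l => (k : ℕ) < d with hJ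
    set E : Fin L → FracPOD.lipZero := fun i => U i - ∑ k ∈ J, B (U i) (Ψ k) • Ψ k with hE
    have herr : ∀ i, u (idx i) - P (u (idx i)) = (E i : ℝ × ℝ → ℝ) := by
      intro i
      rw [(hritz (U i) _).1 (hP _ (hmem i))]
      rfl
    have htot := FracPOD.sum_bilin_pod_error hs0 hpod.orthonormal heig hΨ hdim J
    have hJc : Jᶜ = Finset.univ.filter fun k : Fin l => d ≤ (k : ℕ) := by
      ext k; simp [hJ]
    rw [hJc] at htot
    simp only [hs2, ← Finset.mul_sum] at htot
    simp only [herr]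
    refine ⟨fun i => ⟨(FracPOD.bddMeas_leftX (by linarith) (E i).2).memLp 2,
      (FracPOD.bddMeas_leftY (by linarith) (E i).2).memLp 2⟩, ?_⟩
    rw [one_mul, ← mul_add, ← Finset.sum_add_distrib, one_div, inv_mul_le_iff₀ hL, ← htot]
    exact Finset.sum_le_sum fun i _ =>
      FracPOD.normSq_add_normSq_le_form hα hα' hβ hβ' (E i).2
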